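/- Let $(\overline M,\overline g)$ be a semi-Riemannian manifold of constant sectional curvature $c\in\mathbb R$, with Levi-Civita connection $\overline\nabla$. Let $M$ be a lightlike hypersurface of $\overline M$, i.e. a manifold with $\dim \overline M=\dim M+1$, immersed in $\overline M$, such that $\mathrm{Rad}\,TM=TM\cap TM^{\perp}$ is a smooth distribution of rank one. Let $g$ be the induced (degenerate) metric and let $S(TM)$ be a screen distribution, i.e. a smooth distribution on $M$ with $TM=\mathrm{Rad}\,TM\oplus S(TM)$. Let $tr(TM)$ be the associated lightlike transversal line bundle, spanned locally by the null vector field $N$ orthogonal to $S(TM)$ with $\overline g(N,\xi)=1$ for a local nowhere zero section $\xi$ of $\mathrm{Rad}\,TM$; then $T\overline M|_M=TM\oplus tr(TM)$. The induced connection $\nabla$ and the second fundamental form $h$ of $(M,g,S(TM))$ are defined by $$\overline\nabla_XY=\nabla_XY+h(X,Y),\qquad \nabla_XY\in\Gamma(TM),\quad h(X,Y)\in\Gamma(tr(TM)),\qquad X,Y\in\Gamma(TM),$$ and $R(X,Y)Z=\nabla_X\nabla_YZ-\nabla_Y\nabla_XZ-\nabla_{[X,Y]}Z$ is the curvature tensor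 of $\nabla$. Call $M$ totally geodesic if $h=0$, and call $(M,g,S(TM))$ locally symmetric if for all $W,X,Y,Z\in\Gamma(TM)$, $T\in\Gamma(S(TM))$ and $N\in\Gamma(tr(TM))$ $$g\big((\nabla_WR)(X,Y)Z,T\big)=0\quad\text{and}\quad \overline g\big((\nabla_WR)(X,Y)Z,N\big)=0 .$$ If $M$ is totally geodesic, then $(M,g,S(TM))$ is locally symmetric. If $c\neq 0$, then $(M,g,S(TM))$ is locally symmetric if and only if $M$ is totally geodesic. -/

import Mathlib

open scoped Manifold ContDiff Bundle
open Bundle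

noncomputable section

namespace Lightlike

/-! ### Vector fields, distributions, curvature

All manifolds are finite-dimensional, smooth, Hausdorff, second countable and without boundary. A
vector field on `M` is a function `X : Π p, TangentSpace 𝓘(ℝ, E) p`. -/

section General

variable {E : Type*} [NormedAddCommGroup E] [NormedSpace ℝ E]
  {M : Type*} [TopologicalSpace M] [ChartedSpace E M] [IsManifold 𝓘(ℝ, E) ∞ M]

/-- `X` is a smooth vector field, `X ∈ Γ(TM)`. -/
def IsSmoothVF (X : Π p : M, TangentSpace 𝓘(ℝ, E) p) : Prop :=
  ContMDiff 𝓘(ℝ, E) 𝓘(ℝ, E).tangent ∞ (fun p ↦ (⟨p, X p⟩ : TangentBundle 𝓘(ℝ, E) M))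

/-- `S` is a smooth distribution of rank `k`: around each point it is spanned by `k` pointwise
linearly independent smooth local vector fields. -/
def IsSmoothDistribution (k : ℕ) (S : Π p : M, Submodule ℝ (TangentSpace 𝓘(ℝ, E) p)) : Prop :=
  ∀ p : M, ∃ U : Set M, IsOpen U ∧ p ∈ U ∧
    ∃ s : Fin k → Π q : M, TangentSpace 𝓘(ℝ, E) q,
      (∀ j, ContMDiffOn 𝓘(ℝ, E) 𝓘(ℝ, E).tangent ∞
        (fun q ↦ (⟨q, s j q⟩ : TangentBundle 𝓘(ℝ, E) M)) U) ∧
      ∀ q ∈ U, LinearIndependent ℝ (fun j ↦ s j q) ∧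
        Submodule.span ℝ (Set.range fun j ↦ s j q) = S q

/-- The curvature `R(X,Y)Z = ∇_X ∇_Y Z - ∇_Y ∇_X Z - ∇_[X,Y] Z` of a connection on the tangent
bundle, where `∇ Z p v` stands for `(∇_v Z)(p)`. -/
def curvature
    (nab : (Π p : M, TangentSpace 𝓘(ℝ, E) p) →
      Π p : M, TangentSpace 𝓘(ℝ, E) p → TangentSpace 𝓘(ℝ, E) p)
    (X Y Z : Π p : M, TangentSpace 𝓘(ℝ, E) p) (p : M) : TangentSpace 𝓘(ℝ, E) p :=
  nab (fun q ↦ nab Z q (Y q)) p (X p) - nab (fun q ↦ nab Z q (X q)) p (Y p)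
    - nab Z p (VectorField.mlieBracket 𝓘(ℝ, E) X Y p)

/-- The covariant derivative of the curvature tensor of a connection,
`(∇_W R)(X,Y)Z = ∇_W (R(X,Y)Z) - R(∇_W X,Y)Z - R(X,∇_W Y)Z - R(X,Y)∇_W Z`. -/
def covDerivCurvature
    (nab : (Π p : M, TangentSpace 𝓘(ℝ, E) p) →
      Π p : M, TangentSpace 𝓘(ℝ, E) p → TangentSpace 𝓘(ℝ, E) p)
    (W X Y Z : Π p : M, TangentSpace 𝓘(ℝ, E) p) (p : M) : TangentSpace 𝓘(ℝ, E) p :=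
  nab (curvature nab X Y Z) p (W p)
    - curvature nab (fun q ↦ nab X q (W q)) Y Z p
    - curvature nab X (fun q ↦ nab Y q (W q)) Z p
    - curvature nab X Y (fun q ↦ nab Z q (W q)) p

end General

/-! ### Semi-Riemannian manifolds -/

section SemiRiemannian

variable {E' : Type*} [NormedAddCommGroup E'] [NormedSpace ℝ E']
  {N : Type*} [TopologicalSpace N] [ChartedSpace E' N] [IsManifold 𝓘(ℝ, E') ∞ N]

variable (E' N) in
/-- A semi-Riemannian metric on `N`: a smooth field of nondegenerate symmetric bilinear forms of
constant index. -/
structure SemiRiemannianMetric where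
  /-- the scalar product on each tangent space -/
  val (x : N) : TangentSpace 𝓘(ℝ, E') x →L[ℝ] TangentSpace 𝓘(ℝ, E') x →L[ℝ] ℝ
  symm (x : N) (v w : TangentSpace 𝓘(ℝ, E') x) : val x v w = val x w v
  nondegenerate (x : N) (v : TangentSpace 𝓘(ℝ, E') x) : (∀ w, val x v w = 0) → v = 0
  contMDiff : ContMDiff 𝓘(ℝ, E') (𝓘(ℝ, E').prod 𝓘(ℝ, E' →L[ℝ] E' →L[ℝ] ℝ)) ∞
    (fun x ↦ TotalSpace.mk' (E' →L[ℝ] E' →L[ℝ] ℝ)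
      (E := fun x : N ↦ TangentSpace 𝓘(ℝ, E') x →L[ℝ] TangentSpace 𝓘(ℝ, E') x →L[ℝ] ℝ)
      x (val x))
  /-- the index: the largest dimension of a negative definite subspace of a tangent space -/
  index : ℕ
  isGreatest_index (x : N) :
    IsGreatest {k | ∃ W : Submodule ℝ (TangentSpace 𝓘(ℝ, E') x),
      Module.finrank ℝ W = k ∧ ∀ w ∈ W, w ≠ 0 → val x w w < 0} index

/-- The connection `D` on `TN` is the Levi-Civita connection of `g`: it is smooth, compatible with
the metric, `v(g(Y,Z)) = g(∇_v Y,Z) + g(Y,∇_v Z)`, and torsion-free. Here `D Y x v` is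
`(∇_v Y)(x)`. -/
structure SemiRiemannianMetric.IsLeviCivita (g : SemiRiemannianMetric E' N)
    (D : CovariantDerivative 𝓘(ℝ, E') E' (TangentSpace 𝓘(ℝ, E') : N → Type _)) : Prop where
  smooth : ContMDiffCovariantDerivativeOn E' ∞ D.toFun Set.univ
  metric (Y Z : Π x : N, TangentSpace 𝓘(ℝ, E') x) (x : N) (v : TangentSpace 𝓘(ℝ, E') x)
    (hY : MDifferentiableAt 𝓘(ℝ, E') 𝓘(ℝ, E').tangent
      (fun y ↦ (⟨y, Y y⟩ : TangentBundle 𝓘(ℝ, E') N)) x)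
    (hZ : MDifferentiableAt 𝓘(ℝ, E') 𝓘(ℝ, E').tangent
      (fun y ↦ (⟨y, Z y⟩ : TangentBundle 𝓘(ℝ, E') N)) x) :
    mvfderiv 𝓘(ℝ, E') (fun y ↦ g.val y (Y y) (Z y)) x v
      = g.val x (D Y x v) (Z x) + g.val x (Y x) (D Z x v)
  torsion_free (X Y : Π x : N, TangentSpace 𝓘(ℝ, E') x) (x : N)
    (hX : MDifferentiableAt 𝓘(ℝ, E') 𝓘(ℝ, E').tangent
      (fun y ↦ (⟨y, X y⟩ : TangentBundle 𝓘(ℝ, E') N)) x)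
    (hY : MDifferentiableAt 𝓘(ℝ, E') 𝓘(ℝ, E').tangent
      (fun y ↦ (⟨y, Y y⟩ : TangentBundle 𝓘(ℝ, E') N)) x) :
    D Y x (X x) - D X x (Y x) = VectorField.mlieBracket 𝓘(ℝ, E') X Y x

/-- `(N, g)`, with Levi-Civita connection `D`, has constant sectional curvature `c`: every
nondegenerate tangent plane, spanned by `X` and `Y` say, has sectional curvature
`g(R(X,Y)Y,X) / (g(X,X) g(Y,Y) - g(X,Y)²) = c`. -/
def SemiRiemannianMetric.HasConstantSectionalCurvature (g : SemiRiemannianMetric E' N)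
    (D : CovariantDerivative 𝓘(ℝ, E') E' (TangentSpace 𝓘(ℝ, E') : N → Type _)) (c : ℝ) : Prop :=
  ∀ X Y : Π x : N, TangentSpace 𝓘(ℝ, E') x, IsSmoothVF X → IsSmoothVF Y → ∀ x : N,
    g.val x (X x) (X x) * g.val x (Y x) (Y x) - g.val x (X x) (Y x) ^ 2 ≠ 0 →
    g.val x (curvature (fun Z y v ↦ D Z y v) X Y Y x) (X x)
        / (g.val x (X x) (X x) * g.val x (Y x) (Y x) - g.val x (X x) (Y x) ^ 2) = c

end SemiRiemannian

/-! ### Lightlike hypersurfaces and their induced objects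

A hypersurface of `N` is a manifold `M` with `dim N = dim M + 1` and an immersion `i : M → N`. -/

section Hypersurface

variable {E : Type*} [NormedAddCommGroup E] [NormedSpace ℝ E]
  {M : Type*} [TopologicalSpace M] [ChartedSpace E M] [IsManifold 𝓘(ℝ, E) ∞ M]
  {E' : Type*} [NormedAddCommGroup E'] [NormedSpace ℝ E'] [FiniteDimensional ℝ E']
  {N : Type*} [TopologicalSpace N] [ChartedSpace E' N] [IsManifold 𝓘(ℝ, E') ∞ N]

/-- The differential `T_p M → T_{i p} N` of `i`. -/
def diff (i : M → N) (p : M) : TangentSpace 𝓘(ℝ, E) p →L[ℝ] TangentSpace 𝓘(ℝ, E') (i p) :=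
  mfderiv 𝓘(ℝ, E) 𝓘(ℝ, E') i p

/-- The (possibly degenerate) metric on `M` induced by `g` through `i`. -/
def inducedMetric (g : SemiRiemannianMetric E' N) (i : M → N) (p : M)
    (v w : TangentSpace 𝓘(ℝ, E) p) : ℝ :=
  g.val (i p) (diff i p v) (diff i p w)

/-- The radical `Rad T_p M = T_p M ∩ (T_p M)^⊥` of the induced metric. -/
def radical (g : SemiRiemannianMetric E' N) (i : M → N) (p : M) :
    Submodule ℝ (TangentSpace 𝓘(ℝ, E) p) where
  carrier := {v | ∀ w, inducedMetric g i p v w = 0}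
  add_mem' {a b} ha hb w := by
    have h1 := ha w
    have h2 := hb w
    simp only [inducedMetric] at h1 h2 ⊢
    simp [h1, h2]
  zero_mem' w := by simp [inducedMetric]
  smul_mem' t a ha w := by
    have h1 := ha w
    simp only [inducedMetric] at h1 ⊢
    simp [h1]

/-- `i : M → N` is a lightlike hypersurface of `(N, g)`: an immersion of codimension one such that
`Rad TM` is a smooth distribution of rank one. -/
structure IsLightlikeHypersurface (g : SemiRiemannianMetric E' N) (i : M → N) : Prop where
  contMDiff : ContMDiff 𝓘(ℝ, E) 𝓘(ℝ, E') ∞ i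
  injective (p : M) : Function.Injective (diff (E := E) (E' := E') i p)
  codim : Module.finrank ℝ E' = Module.finrank ℝ E + 1
  radical : IsSmoothDistribution 1 (radical (E := E) g i)

/-- A screen distribution `S(TM)`: a smooth distribution complementary to `Rad TM` in `TM`. The
induced metric is automatically nondegenerate on it. -/
structure ScreenDistribution (g : SemiRiemannianMetric E' N) (i : M → N) where
  /-- the fibre of `S(TM)` over a point -/
  fiber (p : M) : Submodule ℝ (TangentSpace 𝓘(ℝ, E) p)
  smooth : IsSmoothDistribution (Module.finrank ℝ E - 1) fiber
  isCompl (p : M) : IsCompl (radical g i p) (fiber p)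

/-- The fibre over `p` of the lightlike transversal bundle `tr(TM)` determined by the screen: the
line spanned by the null vectors `n` orthogonal to `S(TM)` with `g(n, ξ) = 1` for some `ξ` in
`Rad TM`. -/
def transversal (g : SemiRiemannianMetric E' N) (i : M → N)
    (S : ScreenDistribution (E := E) g i) (p : M) : Submodule ℝ (TangentSpace 𝓘(ℝ, E') (i p)) :=
  Submodule.span ℝ {n | g.val (i p) n n = 0 ∧ (∀ w ∈ S.fiber p, g.val (i p) n (diff i p w) = 0) ∧
    ∃ ξ ∈ radical (E := E) g i p, g.val (i p) n (diff i p ξ) = 1}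

open Classical in
/-- The component in `T_p M` of a vector of `T_{i p} N = di(T_p M) ⊕ tr(TM)_p`. -/
def tangentPart (g : SemiRiemannianMetric E' N) (i : M → N)
    (S : ScreenDistribution (E := E) g i) (p : M) (v : TangentSpace 𝓘(ℝ, E') (i p)) :
    TangentSpace 𝓘(ℝ, E) p :=
  if h : ∃ u : TangentSpace 𝓘(ℝ, E) p, v - diff i p u ∈ transversal g i S p then h.choose else 0

/-- The covariant derivative along `i` (the pullback connection on `i*TN`) of a vector field `V`
along `i`, in the direction `u ∈ T_p M`. If `V = ∑ⱼ Vʲ (sⱼ ∘ i)` near `p` for a local frame `sⱼ` of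
`TN` around `i p`, it equals `∑ⱼ (u(Vʲ) sⱼ + Vʲ ∇_{di(u)} sⱼ)` at `p`, which does not depend on the
frame; we take a coordinate frame around `i p`. -/
def covAlong (D : CovariantDerivative 𝓘(ℝ, E') E' (TangentSpace 𝓘(ℝ, E') : N → Type _)) (i : M → N)
    (V : Π p : M, TangentSpace 𝓘(ℝ, E') (i p)) (p : M) (u : TangentSpace 𝓘(ℝ, E) p) :
    TangentSpace 𝓘(ℝ, E') (i p) :=
  let e := trivializationAt E' (TangentSpace 𝓘(ℝ, E') : N → Type _) (i p)
  let b := Module.finBasis ℝ E'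
  ∑ j, (mvfderiv 𝓘(ℝ, E) (fun q ↦ e.localFrameCoeff 𝓘(ℝ, E') b j (i q) (V q)) p u
          • e.localFrame b j (i p)
        + e.localFrameCoeff 𝓘(ℝ, E') b j (i p) (V p) • D (e.localFrame b j) (i p) (diff i p u))

/-- The induced connection `∇` on `M`: the tangential part in the Gauss formula
`∇̄_u Y = ∇_u Y + h(u, Y)`. -/
def inducedConnection (g : SemiRiemannianMetric E' N)
    (D : CovariantDerivative 𝓘(ℝ, E') E' (TangentSpace 𝓘(ℝ, E') : N → Type _)) (i : M → N)
    (S : ScreenDistribution (E := E) g i)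
    (Y : Π p : M, TangentSpace 𝓘(ℝ, E) p) (p : M) (u : TangentSpace 𝓘(ℝ, E) p) :
    TangentSpace 𝓘(ℝ, E) p :=
  tangentPart g i S p (covAlong D i (fun q ↦ diff i q (Y q)) p u)

/-- The second fundamental form `h(X, Y) = ∇̄_X Y - ∇_X Y`, with values in `tr(TM)`. -/
def secondFundamentalForm (g : SemiRiemannianMetric E' N)
    (D : CovariantDerivative 𝓘(ℝ, E') E' (TangentSpace 𝓘(ℝ, E') : N → Type _)) (i : M → N)
    (S : ScreenDistribution (E := E) g i)
    (X Y : Π p : M, TangentSpace 𝓘(ℝ, E) p) (p : M) : TangentSpace 𝓘(ℝ, E') (i p) :=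
  covAlong D i (fun q ↦ diff i q (Y q)) p (X p) - diff i p (inducedConnection g D i S Y p (X p))

/-- `M` is totally geodesic: its second fundamental form vanishes. -/
def IsTotallyGeodesic (g : SemiRiemannianMetric E' N)
    (D : CovariantDerivative 𝓘(ℝ, E') E' (TangentSpace 𝓘(ℝ, E') : N → Type _)) (i : M → N)
    (S : ScreenDistribution (E := E) g i) : Prop :=
  ∀ X Y : Π p : M, TangentSpace 𝓘(ℝ, E) p, IsSmoothVF X → IsSmoothVF Y →
    ∀ p : M, secondFundamentalForm g D i S X Y p = 0

/-- `(M, g, S(TM))` is locally symmetric: the covariant derivative with respect to the induced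
connection `∇` of its curvature `R` satisfies `g((∇_W R)(X,Y)Z, T) = 0` for all `T` in `S(TM)` and
`ḡ((∇_W R)(X,Y)Z, n) = 0` for all `n` in `tr(TM)`. -/
def IsLocallySymmetric (g : SemiRiemannianMetric E' N)
    (D : CovariantDerivative 𝓘(ℝ, E') E' (TangentSpace 𝓘(ℝ, E') : N → Type _)) (i : M → N)
    (S : ScreenDistribution (E := E) g i) : Prop :=
  ∀ W X Y Z : Π p : M, TangentSpace 𝓘(ℝ, E) p,
    IsSmoothVF W → IsSmoothVF X → IsSmoothVF Y → IsSmoothVF Z → ∀ p : M,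
      (∀ t ∈ S.fiber p,
        inducedMetric g i p (covDerivCurvature (inducedConnection g D i S) W X Y Z p) t = 0) ∧
      ∀ n ∈ transversal g i S p,
        g.val (i p) (diff i p (covDerivCurvature (inducedConnection g D i S) W X Y Z p)) n = 0

end Hypersurface

end Lightlike

end

/-! Near each point choose a radical field `ξ` and the null field `n` orthogonal to the screen with
`ḡ(n, ξ) = 1`. Since `ξ^⊥ = TM`, the Gauss formula reads `∇̄_X Y = ∇_X Y + B(X,Y) n`, where `B(X,Y)
= ḡ(∇̄_X Y, ξ) = -ḡ(Y, ∇̄_X ξ)`. Constant curvature means `R̄(X,Y)Z = c (g(Y,Z) X - g(X,Z) Y)`.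

If `h = 0`, then `∇` is the restriction of `∇̄`, so it preserves `g` and its curvature is given by
the same formula. A tensor built from `g` alone is parallel, so `∇R = 0`
(`IsTotallyGeodesic.covDerivCurvature_eq_zero`).

For the converse, `B(·,ξ) = 0`, so `∇ξ = ∇̄ξ`, and `R(X,Y)ξ` is the tangential part of `R̄(X,Y)ξ =
0` (`curvature_radical_eq_zero`). Hence `(∇_W R)(ξ,Y)ξ = -R(ξ,Y)∇_W ξ`. Moreover `R` and `R̄` have
the same pairing with `n`, because `n` and `∇̄n` are both orthogonal to `n`
(`apply_curvature_transversal`). Pairing with `n` therefore gives `-c g(Y, ∇_W ξ) = c B(W,Y)`, and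
`c ≠ 0` forces `B = 0` (`IsLocallySymmetric.isTotallyGeodesic`).

Most of the work prepares these computations. Fields along `i` need not extend to `N`;
`SmoothAlong.induction` reduces statements about them to restrictions of fields on `N`. The full
curvature tensor is recovered from sectional curvature in `curvature_eq` and pulled back in
`curvature_along`. -/

noncomputable section

namespace Lightlike

open Filter Topology

set_option linter.unusedSectionVars false

/-! ### Smooth vector fields along a map, cut-offs and frames. -/

section Along

variable {E : Type*} [NormedAddCommGroup E] [NormedSpace ℝ E]
  {M : Type*} [TopologicalSpace M] [ChartedSpace E M]
  {E' : Type*} [NormedAddCommGroup E'] [NormedSpace ℝ E']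
  {N : Type*} [TopologicalSpace N] [ChartedSpace E' N] [IsManifold 𝓘(ℝ, E') ∞ N]

/-- Smoothness at `p` of a vector field `V` along the map `i : M → N`. -/
def SmoothAlongAt (i : M → N) (V : Π p : M, TangentSpace 𝓘(ℝ, E') (i p)) (p : M) : Prop :=
  ContMDiffAt 𝓘(ℝ, E) 𝓘(ℝ, E').tangent ∞ (fun q ↦ (⟨i q, V q⟩ : TangentBundle 𝓘(ℝ, E') N)) p

/-- Smoothness of a vector field along the map `i : M → N`. -/
def SmoothAlong (i : M → N) (V : Π p : M, TangentSpace 𝓘(ℝ, E') (i p)) : Prop :=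
  ∀ p, SmoothAlongAt (E := E) i V p

variable {i : M → N} {V W : Π p : M, TangentSpace 𝓘(ℝ, E') (i p)} {p : M}

lemma SmoothAlongAt.base (hV : SmoothAlongAt (E := E) i V p) :
    ContMDiffAt 𝓘(ℝ, E) 𝓘(ℝ, E') ∞ i p :=
  (contMDiffAt_totalSpace.1 hV).1

lemma smoothAlongAt_iff (hi : ContMDiffAt 𝓘(ℝ, E) 𝓘(ℝ, E') ∞ i p) :
    SmoothAlongAt (E := E) i V p ↔ ContMDiffAt 𝓘(ℝ, E) 𝓘(ℝ, E') ∞ (fun q ↦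
      (trivializationAt E' (TangentSpace 𝓘(ℝ, E') : N → Type _) (i p) ⟨i q, V q⟩).2) p := by
  unfold SmoothAlongAt
  rw [contMDiffAt_totalSpace]
  exact ⟨fun h ↦ h.2, fun h ↦ ⟨hi, h⟩⟩

lemma eventually_mem_baseSet (hi : ContMDiffAt 𝓘(ℝ, E) 𝓘(ℝ, E') ∞ i p) :
    ∀ᶠ q in 𝓝 p, i q ∈
      (trivializationAt E' (TangentSpace 𝓘(ℝ, E') : N → Type _) (i p)).baseSet :=
  hi.continuousAt.preimage_mem_nhds ((Trivialization.open_baseSet _).mem_nhds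
    (mem_baseSet_trivializationAt E' (TangentSpace 𝓘(ℝ, E') : N → Type _) (i p)))

lemma SmoothAlongAt.congr (hV : SmoothAlongAt (E := E) i V p) (h : ∀ᶠ q in 𝓝 p, W q = V q) :
    SmoothAlongAt (E := E) i W p :=
  ContMDiffAt.congr_of_eventuallyEq hV (h.mono fun q hq ↦ by simp [hq])

lemma SmoothAlongAt.add (hV : SmoothAlongAt (E := E) i V p) (hW : SmoothAlongAt (E := E) i W p) :
    SmoothAlongAt (E := E) i (fun q ↦ V q + W q) p := by
  have hi := hV.base
  rw [smoothAlongAt_iff hi] at hV hW ⊢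
  refine (hV.add hW).congr_of_eventuallyEq ?_
  filter_upwards [eventually_mem_baseSet hi] with q hq
  exact (Trivialization.linear ℝ _ hq).map_add _ _

lemma SmoothAlongAt.smul {f : M → ℝ} (hf : ContMDiffAt 𝓘(ℝ, E) 𝓘(ℝ) ∞ f p)
    (hV : SmoothAlongAt (E := E) i V p) :
    SmoothAlongAt (E := E) i (fun q ↦ f q • V q) p := by
  have hi := hV.base
  rw [smoothAlongAt_iff hi] at hV ⊢
  refine (hf.smul hV).congr_of_eventuallyEq ?_
  filter_upwards [eventually_mem_baseSet hi] with q hq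
  exact (Trivialization.linear ℝ _ hq).map_smul _ _

lemma smoothAlongAt_zero (hi : ContMDiffAt 𝓘(ℝ, E) 𝓘(ℝ, E') ∞ i p) :
    SmoothAlongAt (E := E) i (fun q ↦ (0 : TangentSpace 𝓘(ℝ, E') (i q))) p := by
  rw [smoothAlongAt_iff hi]
  refine (contMDiffAt_const (c := (0 : E'))).congr_of_eventuallyEq ?_
  filter_upwards [eventually_mem_baseSet hi] with q hq
  exact (Trivialization.linear ℝ _ hq).map_zero

lemma SmoothAlongAt.sum {ι : Type*} {s : Finset ι} {V : ι → Π p : M, TangentSpace 𝓘(ℝ, E') (i p)}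
    (hi : ContMDiffAt 𝓘(ℝ, E) 𝓘(ℝ, E') ∞ i p)
    (hV : ∀ j ∈ s, SmoothAlongAt (E := E) i (V j) p) :
    SmoothAlongAt (E := E) i (fun q ↦ ∑ j ∈ s, V j q) p := by
  classical
  induction s using Finset.induction_on with
  | empty => simpa using smoothAlongAt_zero hi
  | insert a s ha ih =>
    simp only [Finset.sum_insert ha]
    exact (hV a (by simp)).add (ih fun j hj ↦ hV j (by simp [hj]))

lemma SmoothAlongAt.sub (hV : SmoothAlongAt (E := E) i V p) (hW : SmoothAlongAt (E := E) i W p) :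
    SmoothAlongAt (E := E) i (fun q ↦ V q - W q) p := by
  have := hV.add (hW.smul (f := fun _ ↦ (-1 : ℝ)) contMDiffAt_const)
  exact this.congr (Eventually.of_forall fun q ↦ by simp [sub_eq_add_neg])

lemma isSmoothVF_iff {s : Π x : N, TangentSpace 𝓘(ℝ, E') x} :
    IsSmoothVF s ↔ SmoothAlong (E := E') id s := Iff.rfl

lemma SmoothAlongAt.comp {s : Π x : N, TangentSpace 𝓘(ℝ, E') x}
    (hs : SmoothAlongAt (E := E') id s (i p)) (hi : ContMDiffAt 𝓘(ℝ, E) 𝓘(ℝ, E') ∞ i p) :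
    SmoothAlongAt (E := E) i (fun q ↦ s (i q)) p :=
  ContMDiffAt.comp p (g := fun x ↦ (⟨x, s x⟩ : TangentBundle 𝓘(ℝ, E') N)) hs hi

/-- Smooth cut-off functions. -/
lemma exists_cutoff [FiniteDimensional ℝ E] [T2Space M] [IsManifold 𝓘(ℝ, E) ∞ M]
    {U : Set M} (hU : U ∈ 𝓝 p) :
    ∃ χ : M → ℝ, ContMDiff 𝓘(ℝ, E) 𝓘(ℝ) ∞ χ ∧ (∀ᶠ q in 𝓝 p, χ q = 1) ∧ tsupport χ ⊆ U := by
  obtain ⟨χ, hχ⟩ := (SmoothBumpFunction.nhds_basis_support (I := 𝓘(ℝ, E)) hU).ex_mem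
  exact ⟨χ, χ.contMDiff, χ.eventuallyEq_one, hχ⟩

/-- Extension by zero: `V` may be arbitrary off the support of `χ`. This turns local constructions
into global fields. -/
lemma SmoothAlong.of_cutoff {χ : M → ℝ} (hi : ContMDiff 𝓘(ℝ, E) 𝓘(ℝ, E') ∞ i)
    (hχ : ContMDiff 𝓘(ℝ, E) 𝓘(ℝ) ∞ χ) (hV : ∀ q ∈ tsupport χ, SmoothAlongAt (E := E) i V q) :
    SmoothAlong (E := E) i (fun q ↦ χ q • V q) := by
  intro q
  by_cases hq : q ∈ tsupport χ
  · exact (hV q hq).smul (hχ q)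
  · refine (smoothAlongAt_zero (hi q)).congr ?_
    filter_upwards [(isClosed_tsupport χ).isOpen_compl.mem_nhds hq] with x hx
    rw [image_eq_zero_of_notMem_tsupport hx, zero_smul]

lemma contMDiff_cutoff {χ f : M → ℝ}
    (hχ : ContMDiff 𝓘(ℝ, E) 𝓘(ℝ) ∞ χ) (hf : ∀ q ∈ tsupport χ, ContMDiffAt 𝓘(ℝ, E) 𝓘(ℝ) ∞ f q) :
    ContMDiff 𝓘(ℝ, E) 𝓘(ℝ) ∞ (fun q ↦ χ q * f q) := by
  intro q
  by_cases hq : q ∈ tsupport χ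
  · exact (hχ q).mul (hf q hq)
  · refine (contMDiffAt_const (c := (0 : ℝ))).congr_of_eventuallyEq ?_
    filter_upwards [(isClosed_tsupport χ).isOpen_compl.mem_nhds hq] with x hx
    rw [image_eq_zero_of_notMem_tsupport hx, zero_mul]

lemma SmoothAlongAt.localFrameCoeff [FiniteDimensional ℝ E'] (hV : SmoothAlongAt (E := E) i V p)
    (e : Trivialization E' (TotalSpace.proj : TangentBundle 𝓘(ℝ, E') N → N))
    [MemTrivializationAtlas e] (hp : i p ∈ e.baseSet) {ι : Type*} (b : Module.Basis ι ℝ E')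
    (j : ι) :
    ContMDiffAt 𝓘(ℝ, E) 𝓘(ℝ) ∞ (fun q ↦ e.localFrameCoeff 𝓘(ℝ, E') b j (i q) (V q)) p := by
  have h1 : ContMDiffAt 𝓘(ℝ, E) 𝓘(ℝ, E') ∞ (fun q ↦ (e ⟨i q, V q⟩).2) p :=
    ((e.contMDiffAt_iff (by simpa [Trivialization.mem_source] using hp)).1 hV).2
  have h2 : ContMDiffAt 𝓘(ℝ, E) 𝓘(ℝ) ∞
      (fun q ↦ LinearMap.toContinuousLinearMap (b.coord j) (e ⟨i q, V q⟩).2) p :=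
    (ContinuousLinearMap.contMDiff _).contMDiffAt.comp p h1
  refine h2.congr_of_eventuallyEq ?_
  filter_upwards [hV.base.continuousAt.preimage_mem_nhds (e.open_baseSet.mem_nhds hp)] with q hq
  classical
  -- `V` is not a section over `N`, so a section with the single prescribed value `V q` at `i q`
  -- stands in for it.
  have := e.localFrameCoeff_eq_coeff (I := 𝓘(ℝ, E')) (b := b) hq (i := j)
    (s := Function.update 0 (i q) (V q))
  simpa using this

/-- Around each point there are a global family of smooth vector fields and coefficient
functionals which represent every tangent vector near the point. -/
lemma exists_frame [FiniteDimensional ℝ E'] [T2Space N] (x₀ : N) :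
    ∃ (s : Fin (Module.finrank ℝ E') → Π x : N, TangentSpace 𝓘(ℝ, E') x)
      (c : Fin (Module.finrank ℝ E') → Π x : N, TangentSpace 𝓘(ℝ, E') x →ₗ[ℝ] ℝ),
      (∀ j, IsSmoothVF (s j)) ∧
      (∀ᶠ x in 𝓝 x₀, ∀ v : TangentSpace 𝓘(ℝ, E') x, v = ∑ j, c j x v • s j x) ∧
      ∀ (i : M → N) (V : Π p : M, TangentSpace 𝓘(ℝ, E') (i p)) (p : M) (j),
        SmoothAlongAt (E := E) i V p →
          ContMDiffAt 𝓘(ℝ, E) 𝓘(ℝ) ∞ (fun q ↦ c j (i q) (V q)) p := by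
  set e := trivializationAt E' (TangentSpace 𝓘(ℝ, E') : N → Type _) x₀
  let b := Module.finBasis ℝ E'
  have hx₀ : x₀ ∈ e.baseSet := mem_baseSet_trivializationAt E' _ x₀
  obtain ⟨χ, hχ, hχ1, hχU⟩ := exists_cutoff (E := E') (e.open_baseSet.mem_nhds hx₀)
  -- Cutting off both the frame and its coefficients makes both globally smooth; the resulting
  -- factor `χ²` is 1 near `x₀`.
  refine ⟨fun j x ↦ χ x • e.localFrame b j x,
    fun j x ↦ χ x • e.localFrameCoeff 𝓘(ℝ, E') b j x, fun j ↦ ?_, ?_, ?_⟩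
  · rw [isSmoothVF_iff]
    refine SmoothAlong.of_cutoff contMDiff_id hχ fun q hq ↦ ?_
    exact contMDiffAt_localFrame_of_mem ∞ e b j (hχU hq)
  · filter_upwards [hχ1, e.open_baseSet.mem_nhds hx₀] with x hx hxe v
    classical
    have := e.eq_sum_localFrameCoeff_smul (I := 𝓘(ℝ, E')) (b := b) hxe (s := Function.update 0 x v)
    simpa [hx] using this
  · intro i V p j hV
    by_cases hp : i p ∈ tsupport χ
    · exact ((hχ (i p)).comp p hV.base).mul (hV.localFrameCoeff e (hχU hp) b j)
    · refine (contMDiffAt_const (c := (0 : ℝ))).congr_of_eventuallyEq ?_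
      filter_upwards [hV.base.continuousAt.preimage_mem_nhds
        ((isClosed_tsupport χ).isOpen_compl.mem_nhds hp)] with x hx
      rw [image_eq_zero_of_notMem_tsupport hx, zero_smul]
      rfl

end Along

/-! ### Vector fields as derivations. -/

section Derivations

variable {E : Type*} [NormedAddCommGroup E] [NormedSpace ℝ E]
  {M : Type*} [TopologicalSpace M] [ChartedSpace E M] [IsManifold 𝓘(ℝ, E) ∞ M]
  {E' : Type*} [NormedAddCommGroup E'] [NormedSpace ℝ E']
  {N : Type*} [TopologicalSpace N] [ChartedSpace E' N] [IsManifold 𝓘(ℝ, E') ∞ N]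

lemma _root_.ContMDiff.mvfderiv_apply {f : M → ℝ} {X : Π p : M, TangentSpace 𝓘(ℝ, E) p}
    (hf : ContMDiff 𝓘(ℝ, E) 𝓘(ℝ) ∞ f) (hX : IsSmoothVF X) :
    ContMDiff 𝓘(ℝ, E) 𝓘(ℝ) ∞ (fun p ↦ mvfderiv 𝓘(ℝ, E) f p (X p)) := by
  have h1 : ContMDiff 𝓘(ℝ, E).tangent 𝓘(ℝ).tangent ∞ (tangentMap 𝓘(ℝ, E) 𝓘(ℝ) f) :=
    hf.contMDiff_tangentMap (by simp)
  exact contMDiff_snd_tangentBundle_modelSpace ℝ 𝓘(ℝ) |>.comp (h1.comp hX)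

lemma smoothAlong_diff {i : M → N} (hi : ContMDiff 𝓘(ℝ, E) 𝓘(ℝ, E') ∞ i)
    {X : Π p : M, TangentSpace 𝓘(ℝ, E) p} (hX : IsSmoothVF X) :
    SmoothAlong (E := E) i (fun p ↦ diff (E := E) (E' := E') i p (X p)) := by
  have h1 : ContMDiff 𝓘(ℝ, E).tangent 𝓘(ℝ, E').tangent ∞ (tangentMap 𝓘(ℝ, E) 𝓘(ℝ, E') i) :=
    hi.contMDiff_tangentMap (by simp)
  exact h1.comp hX

lemma IsSmoothVF.mdifferentiableAt {X : Π p : M, TangentSpace 𝓘(ℝ, E) p} (hX : IsSmoothVF X)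
    (p : M) : MDifferentiableAt 𝓘(ℝ, E) 𝓘(ℝ, E).tangent
      (fun q ↦ (⟨q, X q⟩ : TangentBundle 𝓘(ℝ, E) M)) p :=
  (hX p).mdifferentiableAt (by simp)

lemma IsSmoothVF.add {X Y : Π p : M, TangentSpace 𝓘(ℝ, E) p} (hX : IsSmoothVF X)
    (hY : IsSmoothVF Y) : IsSmoothVF (X + Y) := ContMDiff.add_section hX hY

lemma IsSmoothVF.smul {X : Π p : M, TangentSpace 𝓘(ℝ, E) p} {f : M → ℝ}
    (hf : ContMDiff 𝓘(ℝ, E) 𝓘(ℝ) ∞ f) (hX : IsSmoothVF X) :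
    IsSmoothVF (f • X) := ContMDiff.smul_section hf hX

lemma IsSmoothVF.mlieBracket [CompleteSpace E]
    {X Y : Π p : M, TangentSpace 𝓘(ℝ, E) p} (hX : IsSmoothVF X)
    (hY : IsSmoothVF Y) : IsSmoothVF (VectorField.mlieBracket 𝓘(ℝ, E) X Y) :=
  have : IsManifold 𝓘(ℝ, E) (minSmoothness ℝ 2) M := by
    rw [minSmoothness_of_isRCLikeNormedField]
    exact IsManifold.of_le (n := ∞) ENat.LEInfty.out
  have : IsManifold 𝓘(ℝ, E) (((⊤ : ℕ∞) : WithTop ℕ∞) + 1) M := ‹IsManifold 𝓘(ℝ, E) ∞ M›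
  ContDiff.mlieBracket_vectorField (m := ⊤) (n := ⊤) hX hY (by simp)

/-- Vector fields with a prescribed value. -/
lemma exists_vf [FiniteDimensional ℝ E] [T2Space M] {p : M} (v : TangentSpace 𝓘(ℝ, E) p) :
    ∃ X : Π p : M, TangentSpace 𝓘(ℝ, E) p, IsSmoothVF X ∧ X p = v := by
  obtain ⟨s, c, hs, hc, -⟩ := exists_frame (E := E) (M := M) (E' := E) (N := M) p
  refine ⟨fun q ↦ ∑ j, c j p v • s j q, fun q ↦ ?_, (hc.self_of_nhds v).symm⟩
  exact SmoothAlongAt.sum (i := id) contMDiffAt_id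
    fun j _ ↦ SmoothAlongAt.smul contMDiffAt_const (hs j q)

/-- The Lie bracket of vector fields acts on functions as the commutator. -/
lemma mvfderiv_mlieBracket [FiniteDimensional ℝ E] [T2Space M]
    {X Y : Π p : M, TangentSpace 𝓘(ℝ, E) p} (hX : IsSmoothVF X) (hY : IsSmoothVF Y)
    {f : M → ℝ} (hf : ContMDiff 𝓘(ℝ, E) 𝓘(ℝ) ∞ f) (p : M) :
    mvfderiv 𝓘(ℝ, E) f p (VectorField.mlieBracket 𝓘(ℝ, E) X Y p)
      = mvfderiv 𝓘(ℝ, E) (fun q ↦ mvfderiv 𝓘(ℝ, E) f q (Y q)) p (X p)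
        - mvfderiv 𝓘(ℝ, E) (fun q ↦ mvfderiv 𝓘(ℝ, E) f q (X q)) p (Y p) := by
  have := FiniteDimensional.complete ℝ E
  -- The argument needs a field `Z` with `Z p ≠ 0`, hence positive dimension.
  rcases subsingleton_or_nontrivial E with hE | hE
  · have h0 : ∀ v : TangentSpace 𝓘(ℝ, E) p, v = 0 := fun v ↦ hE.elim _ _
    rw [h0 (VectorField.mlieBracket 𝓘(ℝ, E) X Y p), h0 (X p), h0 (Y p)]
    simp
  obtain ⟨v, hv⟩ := exists_ne (0 : E)
  obtain ⟨Z, hZ, hZp⟩ := exists_vf (E := E) (M := M) (p := p) v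
  have hm : IsManifold 𝓘(ℝ, E) (minSmoothness ℝ 3) M := by
    rw [minSmoothness_of_isRCLikeNormedField]
    exact IsManifold.of_le (n := ∞) ENat.LEInfty.out
  have h2 : ∀ {X : Π p : M, TangentSpace 𝓘(ℝ, E) p}, IsSmoothVF X →
      ContMDiff 𝓘(ℝ, E) 𝓘(ℝ, E).tangent (minSmoothness ℝ 2)
        (fun q ↦ (⟨q, X q⟩ : TangentBundle 𝓘(ℝ, E) M)) := fun h ↦ by
    rw [minSmoothness_of_isRCLikeNormedField]
    exact h.of_le ENat.LEInfty.out
  have md : ∀ {f : M → ℝ}, ContMDiff 𝓘(ℝ, E) 𝓘(ℝ) ∞ f →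
    ∀ q, MDifferentiableAt 𝓘(ℝ, E) 𝓘(ℝ) f q := fun h q ↦ (h q).mdifferentiableAt (by simp)
  have key : ∀ {A B : Π p : M, TangentSpace 𝓘(ℝ, E) p}, IsSmoothVF A → IsSmoothVF B →
      VectorField.mlieBracket 𝓘(ℝ, E) A (VectorField.mlieBracket 𝓘(ℝ, E) B (f • Z)) p =
        mvfderiv 𝓘(ℝ, E) (fun q ↦ mvfderiv 𝓘(ℝ, E) f q (B q)) p (A p) • Z p
        + mvfderiv 𝓘(ℝ, E) f p (B p) • VectorField.mlieBracket 𝓘(ℝ, E) A Z p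
        + (mvfderiv 𝓘(ℝ, E) f p (A p) • VectorField.mlieBracket 𝓘(ℝ, E) B Z p
        + f p • VectorField.mlieBracket 𝓘(ℝ, E) A (VectorField.mlieBracket 𝓘(ℝ, E) B Z) p) := by
    intro A B hA hB
    have h1 : VectorField.mlieBracket 𝓘(ℝ, E) B (f • Z)
        = (fun q ↦ mvfderiv 𝓘(ℝ, E) f q (B q)) • Z + f • VectorField.mlieBracket 𝓘(ℝ, E) B Z := by
      funext q
      rw [VectorField.mlieBracket_smul_right (md hf q) (hZ.mdifferentiableAt q)]
      rfl
    have hBf := hf.mvfderiv_apply hB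
    rw [h1, VectorField.mlieBracket_add_right ((hZ.smul hBf).mdifferentiableAt p)
      (((hB.mlieBracket hZ).smul hf).mdifferentiableAt p),
      VectorField.mlieBracket_smul_right (md hBf p) (hZ.mdifferentiableAt p),
      VectorField.mlieBracket_smul_right (md hf p) ((hB.mlieBracket hZ).mdifferentiableAt p)]
  -- Compare the Jacobi identity for `X, Y, f Z` with `f` times the one for `X, Y, Z`: what remains
  -- is the desired scalar identity multiplied by `Z p`.
  have hJ := VectorField.leibniz_identity_mlieBracket_apply (h2 hX p) (h2 hY p)
    (h2 (hZ.smul hf) p)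
  have hJ' := VectorField.leibniz_identity_mlieBracket_apply (h2 hX p) (h2 hY p) (h2 hZ p)
  rw [key hX hY, key hY hX, VectorField.mlieBracket_smul_right (md hf p)
    (hZ.mdifferentiableAt p), hJ'] at hJ
  have h3 : (mvfderiv 𝓘(ℝ, E) f p (VectorField.mlieBracket 𝓘(ℝ, E) X Y p)
      - (mvfderiv 𝓘(ℝ, E) (fun q ↦ mvfderiv 𝓘(ℝ, E) f q (Y q)) p (X p)
        - mvfderiv 𝓘(ℝ, E) (fun q ↦ mvfderiv 𝓘(ℝ, E) f q (X q)) p (Y p))) • Z p = 0 := by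
    rw [← sub_eq_zero] at hJ
    rw [← neg_eq_zero, ← hJ]
    module
  rw [hZp] at h3
  exact sub_eq_zero.1 ((smul_eq_zero.1 h3).resolve_right hv)

/-- Smooth functions separate tangent vectors. -/
lemma eq_zero_of_mvfderiv_eq_zero [FiniteDimensional ℝ E] [T2Space M] {p : M}
    {v : TangentSpace 𝓘(ℝ, E) p}
    (h : ∀ f : M → ℝ, ContMDiff 𝓘(ℝ, E) 𝓘(ℝ) ∞ f → mvfderiv 𝓘(ℝ, E) f p v = 0) : v = 0 := by
  obtain ⟨χ, hχ, hχ1, hχU⟩ := exists_cutoff (E := E) (chart_source_mem_nhds E p)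
  have hch : MDifferentiableAt 𝓘(ℝ, E) 𝓘(ℝ, E) (extChartAt 𝓘(ℝ, E) p) p :=
    (contMDiffAt_extChartAt (n := ∞)).mdifferentiableAt (by simp)
  have hv : mfderiv 𝓘(ℝ, E) 𝓘(ℝ, E) (extChartAt 𝓘(ℝ, E) p) p v = 0 := by
    by_contra hne
    obtain ⟨l, hl⟩ : ∃ l : E →L[ℝ] ℝ,
        l (mfderiv 𝓘(ℝ, E) 𝓘(ℝ, E) (extChartAt 𝓘(ℝ, E) p) p v) ≠ 0 :=
      (SeparatingDual.exists_ne_zero (R := ℝ) (V := E) hne)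
    have hs : ∀ q ∈ tsupport χ,
        ContMDiffAt 𝓘(ℝ, E) 𝓘(ℝ) ∞ (fun q ↦ l (extChartAt 𝓘(ℝ, E) p q)) q := fun q hq ↦
      l.contMDiff.contMDiffAt.comp q (contMDiffAt_extChartAt' (hχU hq))
    have h1 := h _ (contMDiff_cutoff hχ hs)
    have h2 : (fun q ↦ χ q * l (extChartAt 𝓘(ℝ, E) p q)) =ᶠ[𝓝 p]
        (l ∘ (extChartAt 𝓘(ℝ, E) p)) := hχ1.mono fun q hq ↦ by simp [hq]
    rw [mvfderiv, h2.mfderiv_eq] at h1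
    have h3 := mfderiv_comp_apply p (l.mdifferentiableAt (x := extChartAt 𝓘(ℝ, E) p p)) hch v
    rw [l.mfderiv_eq] at h3
    exact hl (h3.symm.trans h1)
  exact (isInvertible_mfderiv_extChartAt (mem_extChartAt_source (I := 𝓘(ℝ, E)) p)).injective
    (hv.trans (map_zero _).symm)

end Derivations

/-! ### The pullback connection along `i`. -/

section CovAlong

variable {E : Type*} [NormedAddCommGroup E] [NormedSpace ℝ E]
  {M : Type*} [TopologicalSpace M] [ChartedSpace E M] [IsManifold 𝓘(ℝ, E) ∞ M]
  {E' : Type*} [NormedAddCommGroup E'] [NormedSpace ℝ E'] [FiniteDimensional ℝ E']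
  {N : Type*} [TopologicalSpace N] [ChartedSpace E' N] [IsManifold 𝓘(ℝ, E') ∞ N]
  {D : CovariantDerivative 𝓘(ℝ, E') E' (TangentSpace 𝓘(ℝ, E') : N → Type _)}
  {i : M → N} {V W : Π p : M, TangentSpace 𝓘(ℝ, E') (i p)} {p : M}

/-- Near `p` every field along `i` is a combination `∑ fⱼ (sⱼ ∘ i)`. So a property that is local at
`p` and stable under sums and function multiples need only be checked on restrictions `s ∘ i`. -/
lemma SmoothAlong.induction [T2Space N]
    (hi : ContMDiff 𝓘(ℝ, E) 𝓘(ℝ, E') ∞ i) (p : M)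
    {P : (Π p : M, TangentSpace 𝓘(ℝ, E') (i p)) → Prop}
    (congr : ∀ V W, SmoothAlong (E := E) i V → SmoothAlong (E := E) i W →
      (∀ᶠ q in 𝓝 p, W q = V q) → P V → P W)
    (add : ∀ V W, SmoothAlong (E := E) i V → SmoothAlong (E := E) i W → P V → P W →
      P (fun q ↦ V q + W q))
    (smul : ∀ (f : M → ℝ) V, ContMDiff 𝓘(ℝ, E) 𝓘(ℝ) ∞ f → SmoothAlong (E := E) i V → P V →
      P (fun q ↦ f q • V q))
    (comp : ∀ s : Π x : N, TangentSpace 𝓘(ℝ, E') x, IsSmoothVF s → P (fun q ↦ s (i q)))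
    (hV : SmoothAlong (E := E) i V) : P V := by
  obtain ⟨s, c, hs, hc, hcs⟩ := exists_frame (E := E) (M := M) (E' := E') (N := N) (i p)
  have hsi : ∀ j, SmoothAlong (E := E) i (fun q ↦ s j (i q)) :=
    fun j q ↦ SmoothAlongAt.comp (hs j (i q)) (hi q)
  have hf : ∀ j, ContMDiff 𝓘(ℝ, E) 𝓘(ℝ) ∞ (fun q ↦ c j (i q) (V q)) :=
    fun j q ↦ hcs i V q j (hV q)
  have hsum : ∀ t : Finset (Fin (Module.finrank ℝ E')),
      SmoothAlong (E := E) i (fun q ↦ ∑ j ∈ t, c j (i q) (V q) • s j (i q)) :=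
    fun t q ↦ SmoothAlongAt.sum (hi q) fun j _ ↦ (hsi j q).smul (hf j q)
  refine congr _ _ (hsum Finset.univ) hV ?_ ?_
  · filter_upwards [(hi p).continuousAt.eventually hc] with q hq using hq _
  · generalize (Finset.univ : Finset (Fin (Module.finrank ℝ E'))) = t
    classical
    induction t using Finset.induction_on with
    | empty => simpa using comp 0 (fun q ↦ smoothAlongAt_zero (i := id) contMDiffAt_id)
    | insert a t ha ih =>
      simp only [Finset.sum_insert ha]
      exact add _ _ (fun q ↦ (hsi a q).smul (hf a q)) (hsum t)
        (smul _ _ (hf a) (hsi a) (comp _ (hs a))) ih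

lemma covAlong_congr (h : ∀ᶠ q in 𝓝 p, W q = V q) (u : TangentSpace 𝓘(ℝ, E) p) :
    covAlong D i W p u = covAlong D i V p u := by
  unfold covAlong
  dsimp only
  refine Finset.sum_congr rfl fun j _ ↦ ?_
  rw [h.self_of_nhds]
  congr 2
  have h2 : (fun q ↦ (trivializationAt E' (TangentSpace 𝓘(ℝ, E') : N → Type _)
        (i p)).localFrameCoeff 𝓘(ℝ, E') (Module.finBasis ℝ E') j (i q) (W q)) =ᶠ[𝓝 p]
      (fun q ↦ (trivializationAt E' (TangentSpace 𝓘(ℝ, E') : N → Type _)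
        (i p)).localFrameCoeff 𝓘(ℝ, E') (Module.finBasis ℝ E') j (i q) (V q)) :=
    h.mono fun q hq ↦ by simp only [hq]
  simp only [mvfderiv, h2.mfderiv_eq]
  rfl

lemma SmoothAlongAt.mdifferentiableAt_coeff (hV : SmoothAlongAt (E := E) i V p)
    (j : Fin (Module.finrank ℝ E')) :
    MDifferentiableAt 𝓘(ℝ, E) 𝓘(ℝ) (fun q ↦ (trivializationAt E'
      (TangentSpace 𝓘(ℝ, E') : N → Type _) (i p)).localFrameCoeff 𝓘(ℝ, E')
      (Module.finBasis ℝ E') j (i q) (V q)) p :=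
  (hV.localFrameCoeff _ (mem_baseSet_trivializationAt E' _ (i p)) _ j).mdifferentiableAt (by simp)

lemma covAlong_add (hV : SmoothAlongAt (E := E) i V p) (hW : SmoothAlongAt (E := E) i W p)
    (u : TangentSpace 𝓘(ℝ, E) p) :
    covAlong D i (fun q ↦ V q + W q) p u = covAlong D i V p u + covAlong D i W p u := by
  unfold covAlong
  dsimp only
  rw [← Finset.sum_add_distrib]
  refine Finset.sum_congr rfl fun j _ ↦ ?_
  simp only [map_add]
  rw [mvfderiv_fun_add (hV.mdifferentiableAt_coeff j) (hW.mdifferentiableAt_coeff j),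
    add_apply]
  module

lemma covAlong_smul {f : M → ℝ} (hf : MDifferentiableAt 𝓘(ℝ, E) 𝓘(ℝ) f p)
    (hV : SmoothAlongAt (E := E) i V p) (u : TangentSpace 𝓘(ℝ, E) p) :
    covAlong D i (fun q ↦ f q • V q) p u
      = mvfderiv 𝓘(ℝ, E) f p u • V p + f p • covAlong D i V p u := by
  unfold covAlong
  dsimp only
  classical
  have h1 := (trivializationAt E' (TangentSpace 𝓘(ℝ, E') : N → Type _)
    (i p)).eq_sum_localFrameCoeff_smul (I := 𝓘(ℝ, E')) (b := Module.finBasis ℝ E')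
    (mem_baseSet_trivializationAt E' _ (i p)) (s := Function.update 0 (i p) (V p))
  rw [Function.update_self] at h1
  conv_rhs => enter [1, 2]; rw [h1]
  rw [Finset.smul_sum, Finset.smul_sum, ← Finset.sum_add_distrib]
  refine Finset.sum_congr rfl fun j _ ↦ ?_
  simp only [map_smul, smul_eq_mul]
  rw [mvfderiv_fun_mul hf (hV.mdifferentiableAt_coeff j), add_apply,
    smul_apply, smul_apply]
  simp only [smul_eq_mul]
  module

lemma _root_.CovariantDerivative.sum_smul {x : N} {ι : Type*} (t : Finset ι) {f : ι → N → ℝ}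
    {s : ι → Π x : N, TangentSpace 𝓘(ℝ, E') x}
    (hf : ∀ j ∈ t, MDifferentiableAt 𝓘(ℝ, E') 𝓘(ℝ) (f j) x)
    (hs : ∀ j ∈ t, MDifferentiableAt 𝓘(ℝ, E') 𝓘(ℝ, E').tangent
      (fun y ↦ (⟨y, s j y⟩ : TangentBundle 𝓘(ℝ, E') N)) x) :
    D (fun y ↦ ∑ j ∈ t, f j y • s j y) x
      = ∑ j ∈ t, (f j x • D (s j) x + (mvfderiv 𝓘(ℝ, E') (f j) x).smulRight (s j x)) := by
  have hD := D.isCovariantDerivativeOnUniv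
  classical
  induction t using Finset.induction_on with
  | empty =>
    simp only [Finset.sum_empty]
    exact congrFun D.zero x
  | insert a t ha ih =>
    have ih' := ih (fun j hj ↦ hf j (by simp [hj])) (fun j hj ↦ hs j (by simp [hj]))
    have h1 : (fun y ↦ ∑ j ∈ insert a t, f j y • s j y)
        = (f a • s a) + (fun y ↦ ∑ j ∈ t, f j y • s j y) := by
      funext y
      simp [Finset.sum_insert ha]
    rw [h1, Finset.sum_insert ha, ← ih', ← hD.leibniz (hs a (by simp)) (hf a (by simp))]
    exact hD.add (MDifferentiableAt.smul_section (hf a (by simp)) (hs a (by simp)))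
      (MDifferentiableAt.sum_section fun j hj ↦
        MDifferentiableAt.smul_section (hf j (by simp [hj])) (hs j (by simp [hj])))

/-- The Leibniz rule for `D` in the coordinate frame, together with the chain rule for the
coefficients, reproduces the definition of `covAlong`. -/
lemma covAlong_comp (hi : ContMDiff 𝓘(ℝ, E) 𝓘(ℝ, E') ∞ i)
    {s : Π x : N, TangentSpace 𝓘(ℝ, E') x} (hs : IsSmoothVF s) (u : TangentSpace 𝓘(ℝ, E) p) :
    covAlong D i (fun q ↦ s (i q)) p u = D s (i p) (diff i p u) := by
  set e := trivializationAt E' (TangentSpace 𝓘(ℝ, E') : N → Type _) (i p) with he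
  set b := Module.finBasis ℝ E' with hb
  have hp : i p ∈ e.baseSet := mem_baseSet_trivializationAt E' _ (i p)
  have hc : ∀ j, MDifferentiableAt 𝓘(ℝ, E') 𝓘(ℝ)
      (fun x ↦ e.localFrameCoeff 𝓘(ℝ, E') b j x (s x)) (i p) := fun j ↦
    (SmoothAlongAt.localFrameCoeff (i := id) (hs (i p)) e hp b j).mdifferentiableAt (by simp)
  have he' : ∀ j, MDifferentiableAt 𝓘(ℝ, E') 𝓘(ℝ, E').tangent
      (fun y ↦ (⟨y, e.localFrame b j y⟩ : TangentBundle 𝓘(ℝ, E') N)) (i p) := fun j ↦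
    (contMDiffAt_localFrame_of_mem ∞ e b j hp).mdifferentiableAt (by simp)
  have h1 : D s (i p) = D (fun x ↦ ∑ j, e.localFrameCoeff 𝓘(ℝ, E') b j x (s x)
      • e.localFrame b j x) (i p) := by
    refine D.isCovariantDerivativeOnUniv.congr_of_eventuallyEq (hs.mdifferentiableAt _)
      (MDifferentiableAt.sum_section fun j _ ↦ MDifferentiableAt.smul_section (hc j) (he' j))
      univ_mem (e.eventually_eq_localFrame_sum_coeff_smul b hp)
  rw [h1, CovariantDerivative.sum_smul _ (fun j _ ↦ hc j) (fun j _ ↦ he' j)]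
  unfold covAlong
  dsimp only
  rw [sum_apply]
  refine Finset.sum_congr rfl fun j _ ↦ ?_
  have h2 := mvfderiv_comp_apply (I' := 𝓘(ℝ, E)) p (hc j) ((hi p).mdifferentiableAt (by simp)) u
  rw [add_apply, smul_apply,
    ContinuousLinearMap.smulRight_apply, add_comm]
  congr 2

/-- The frame in the definition of `covAlong` changes with the base point, so smoothness cannot be
read off the formula; it follows by induction from fields `s ∘ i`. -/
lemma SmoothAlong.covAlong [T2Space N] (hD : ContMDiffCovariantDerivativeOn E' ∞ D.toFun Set.univ)
    (hi : ContMDiff 𝓘(ℝ, E) 𝓘(ℝ, E') ∞ i) (hV : SmoothAlong (E := E) i V)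
    {X : Π p : M, TangentSpace 𝓘(ℝ, E) p} (hX : IsSmoothVF X) :
    SmoothAlong (E := E) i (fun p ↦ covAlong D i V p (X p)) := by
  intro p
  refine SmoothAlong.induction hi p (V := V)
    (P := fun V ↦ SmoothAlongAt (E := E) i (fun p ↦ Lightlike.covAlong D i V p (X p)) p)
    ?_ ?_ ?_ ?_ hV
  · intro V W _ _ h hV
    refine hV.congr ?_
    filter_upwards [eventually_eventually_nhds.2 h] with q hq using covAlong_congr hq _
  · intro V W hV hW h1 h2
    exact (h1.add h2).congr (Eventually.of_forall fun q ↦ covAlong_add (hV q) (hW q) _)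
  · intro f V hf hV h
    refine (((hV p).smul (hf.mvfderiv_apply hX p)).add (h.smul (hf p))).congr
      (Eventually.of_forall fun q ↦ covAlong_smul ((hf q).mdifferentiableAt (by simp)) (hV q) _)
  · intro s hs
    simp only [covAlong_comp hi hs]
    have h1 := (hD.contMDiff (σ := s) (ContMDiff.contMDiffOn hs)).contMDiffAt
      (x := i p) univ_mem
    exact ContMDiffAt.clm_bundle_apply (h1.comp p (hi p)) (smoothAlong_diff hi hX p)

lemma SemiRiemannianMetric.contMDiffAt_apply (g : SemiRiemannianMetric E' N)
    (hV : SmoothAlongAt (E := E) i V p) (hW : SmoothAlongAt (E := E) i W p) :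
    ContMDiffAt 𝓘(ℝ, E) 𝓘(ℝ) ∞ (fun q ↦ g.val (i q) (V q) (W q)) p := by
  have h : ContMDiffAt 𝓘(ℝ, E) (𝓘(ℝ, E').prod 𝓘(ℝ)) ∞
      (fun m ↦ TotalSpace.mk' ℝ (E := Bundle.Trivial N ℝ) (i m) (g.val (i m) (V m) (W m))) p := by
    apply ContMDiffAt.clm_bundle_apply₂ (F₁ := E') (F₂ := E')
    · exact ContMDiffAt.comp p (g.contMDiff (i p)) hV.base
    · exact hV
    · exact hW
  simp only [contMDiffAt_totalSpace] at h
  exact h.2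

/-- Both sides obey the same sum and product rules in `V` and in `W`. Induction in each variable
leaves two restricted fields, where it is metric compatibility on `N` in the direction `di(u)`. -/
lemma SemiRiemannianMetric.IsLeviCivita.metric_along [T2Space N] {g : SemiRiemannianMetric E' N}
    (hD : g.IsLeviCivita D)
    (hi : ContMDiff 𝓘(ℝ, E) 𝓘(ℝ, E') ∞ i) (hV : SmoothAlong (E := E) i V)
    (hW : SmoothAlong (E := E) i W) (u : TangentSpace 𝓘(ℝ, E) p) :
    mvfderiv 𝓘(ℝ, E) (fun q ↦ g.val (i q) (V q) (W q)) p u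
      = g.val (i p) (covAlong D i V p u) (W p) + g.val (i p) (V p) (covAlong D i W p u) := by
  have md : ∀ {V W : Π p : M, TangentSpace 𝓘(ℝ, E') (i p)}, SmoothAlong (E := E) i V →
      SmoothAlong (E := E) i W →
      MDifferentiableAt 𝓘(ℝ, E) 𝓘(ℝ) (fun q ↦ g.val (i q) (V q) (W q)) p := fun hV hW ↦
    (g.contMDiffAt_apply (hV p) (hW p)).mdifferentiableAt (by simp)
  refine SmoothAlong.induction hi p (V := V) (P := fun V ↦
    mvfderiv 𝓘(ℝ, E) (fun q ↦ g.val (i q) (V q) (W q)) p u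
      = g.val (i p) (Lightlike.covAlong D i V p u) (W p)
        + g.val (i p) (V p) (Lightlike.covAlong D i W p u)) ?_ ?_ ?_ ?_ hV
  · intro V V' _ _ h hV
    have h1 : (fun q ↦ g.val (i q) (V' q) (W q)) =ᶠ[𝓝 p] (fun q ↦ g.val (i q) (V q) (W q)) :=
      h.mono fun q hq ↦ by simp only [hq]
    rw [covAlong_congr h, h.self_of_nhds, ← hV]
    simp only [mvfderiv, h1.mfderiv_eq]
    rfl
  · intro V V' hV hV' h1 h2
    simp only [map_add, add_apply]
    rw [mvfderiv_fun_add (md hV hW) (md hV' hW), covAlong_add (hV p) (hV' p),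
      add_apply, h1, h2]
    simp only [map_add, add_apply]
    ring
  · intro f V hf hV h
    have hf' := (hf p).mdifferentiableAt (n := ∞) (by simp)
    simp only [map_smul, smul_apply, smul_eq_mul]
    rw [mvfderiv_fun_mul hf' (md hV hW), covAlong_smul hf' (hV p)]
    simp only [map_add, add_apply, map_smul, smul_apply,
      smul_eq_mul, h]
    ring
  intro s hs
  have hs' : SmoothAlong (E := E) i (fun q ↦ s (i q)) :=
    fun q ↦ SmoothAlongAt.comp (hs (i q)) (hi q)
  refine SmoothAlong.induction hi p (V := W) (P := fun W ↦
    mvfderiv 𝓘(ℝ, E) (fun q ↦ g.val (i q) (s (i q)) (W q)) p u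
      = g.val (i p) (Lightlike.covAlong D i (fun q ↦ s (i q)) p u) (W p)
        + g.val (i p) (s (i p)) (Lightlike.covAlong D i W p u)) ?_ ?_ ?_ ?_ hW
  · intro V V' _ _ h hV
    have h1 : (fun q ↦ g.val (i q) (s (i q)) (V' q)) =ᶠ[𝓝 p]
        (fun q ↦ g.val (i q) (s (i q)) (V q)) := h.mono fun q hq ↦ by simp only [hq]
    rw [covAlong_congr h, h.self_of_nhds, ← hV]
    simp only [mvfderiv, h1.mfderiv_eq]
    rfl
  · intro V V' hV hV' h1 h2
    simp only [map_add]
    rw [mvfderiv_fun_add (md hs' hV) (md hs' hV'), covAlong_add (hV p) (hV' p),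
      add_apply, h1, h2]
    simp only [map_add]
    ring
  · intro f V hf hV h
    have hf' := (hf p).mdifferentiableAt (n := ∞) (by simp)
    simp only [map_smul, smul_eq_mul]
    rw [mvfderiv_fun_mul hf' (md hs' hV), covAlong_smul hf' (hV p)]
    simp only [map_add, add_apply, map_smul, smul_apply,
      smul_eq_mul, h]
    ring
  intro t ht
  rw [covAlong_comp hi hs, covAlong_comp hi ht,
    ← hD.metric s t (i p) (diff i p u) (hs.mdifferentiableAt _) (ht.mdifferentiableAt _)]
  have h1 : ContMDiffAt 𝓘(ℝ, E') 𝓘(ℝ) ∞ (fun y ↦ g.val y (s y) (t y)) (i p) :=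
    g.contMDiffAt_apply (i := id) (hs (i p)) (ht (i p))
  exact mvfderiv_comp_apply (I' := 𝓘(ℝ, E)) p (h1.mdifferentiableAt (by simp))
    ((hi p).mdifferentiableAt (by simp)) u

end CovAlong

/-! ### Algebraic curvature forms are determined by their sectional values. -/

section Algebra

variable {V : Type*} [AddCommGroup V] [Module ℝ V]

/-- The algebraic symmetries of a covariant curvature tensor. Linearity in the last argument
implies linearity in all of them. -/
structure IsCurvatureLike (F : V → V → V → V → ℝ) : Prop where
  add (x y z v w : V) : F x y z (v + w) = F x y z v + F x y z w
  smul (x y z : V) (a : ℝ) (w : V) : F x y z (a • w) = a * F x y z w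
  antisymm (x y z w : V) : F x y z w = -F y x z w
  antisymm' (x y z w : V) : F x y z w = -F x y w z
  bianchi (x y z w : V) : F x y z w + F y z x w + F z x y w = 0

namespace IsCurvatureLike

variable {F : V → V → V → V → ℝ} (hF : IsCurvatureLike F)
include hF

/-- The classical octahedron argument: four Bianchi identities, one for each cyclic shift of the
arguments, combined using the two skew symmetries. -/
lemma pair_symm (x y z w : V) : F x y z w = F z w x y := by
  have h1 := hF.bianchi x y z w
  have h2 := hF.bianchi y z w x
  have h3 := hF.bianchi z w x y
  have h4 := hF.bianchi w x y z
  have a1 := hF.antisymm' y z x w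
  have a2 := hF.antisymm' z x y w
  have a3 := hF.antisymm' z w y x
  have a4 := hF.antisymm' w y z x
  have a5 := hF.antisymm' w x z y
  have a6 := hF.antisymm' x z w y
  have a7 := hF.antisymm' x y w z
  have a8 := hF.antisymm' y w x z
  have b1 := hF.antisymm z x y w
  have b2 := hF.antisymm w y z x
  have b3 := hF.antisymm x z w y
  have b4 := hF.antisymm y w x z
  have b5 := hF.antisymm z x w y
  have b6 := hF.antisymm w y x z
  linarith

lemma add₃ (x y v w z : V) : F x y (v + w) z = F x y v z + F x y w z := by
  rw [hF.antisymm', hF.add, hF.antisymm' x y v, hF.antisymm' x y w]; ring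

lemma smul₃ (x y : V) (a : ℝ) (w z : V) : F x y (a • w) z = a * F x y w z := by
  rw [hF.antisymm', hF.smul, hF.antisymm' x y w]; ring

lemma add₁ (v w x y z : V) : F (v + w) x y z = F v x y z + F w x y z := by
  rw [hF.pair_symm, hF.add₃, hF.pair_symm v, hF.pair_symm w]

lemma smul₁ (a : ℝ) (w x y z : V) : F (a • w) x y z = a * F w x y z := by
  rw [hF.pair_symm, hF.smul₃, hF.pair_symm w]

lemma add₂ (x v w y z : V) : F x (v + w) y z = F x v y z + F x w y z := by
  rw [hF.pair_symm, hF.add, hF.pair_symm x v, hF.pair_symm x w]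

lemma smul₂ (a : ℝ) (x w y z : V) : F x (a • w) y z = a * F x w y z := by
  rw [hF.pair_symm, hF.smul, hF.pair_symm x w]

/-- A curvature-like form which vanishes on planes vanishes. -/
lemma eq_zero_of_diag (h : ∀ x y, F x y y x = 0) (x y z w : V) : F x y z w = 0 := by
  -- Polarization in `x`: the form `F x y y w` is symmetric in `x` and `w`.
  have h1 : ∀ x y w, F x y y w = 0 := fun x y w ↦ by
    have h2 := h (x + w) y
    rw [hF.add, hF.add₁, hF.add₁, h, h] at h2
    have h3 := hF.pair_symm w y y x
    have h4 := hF.antisymm y x w y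
    have h5 := hF.antisymm' x y w y
    linarith
  -- Polarization in `y` gives skew symmetry in the middle slots. The three Bianchi terms then
  -- coincide, so `3 F = 0`.
  have h2 : ∀ x y z w, F x y z w = -F x z y w := fun x y z w ↦ by
    have h3 := h1 x (y + z) w
    rw [hF.add₃, hF.add₂, hF.add₂, h1, h1] at h3
    linarith
  have h3 := hF.bianchi x y z w
  have h4 := hF.antisymm z x y w
  have h5 := h2 x y z w
  have h6 := h2 y z x w
  have h7 := hF.antisymm y x z w
  linarith

/-- The vanishing on the planes which are nondegenerate for a bilinear form suffices, if there is
one such plane. -/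
lemma eq_zero_of_nondegenerate_diag (b : V →ₗ[ℝ] V →ₗ[ℝ] ℝ)
    (h : ∀ x y, b x x * b y y - b x y ^ 2 ≠ 0 → F x y y x = 0) {x₀ y₀ : V}
    (h₀ : b x₀ x₀ * b y₀ y₀ - b x₀ y₀ ^ 2 ≠ 0) (x y z w : V) : F x y z w = 0 := by
  refine hF.eq_zero_of_diag (fun x y ↦ ?_) x y z w
  -- Move the possibly degenerate pair `(x, y)` to `(x + t x₀, y + t y₀)`. `P` is the value of `F`
  -- and `Q` the Gram determinant there, both as polynomials in `t`.
  let P : Polynomial ℝ := Polynomial.C (F x y y x)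
    + Polynomial.C (F x₀ y y x + F x y₀ y x + F x y y₀ x + F x y y x₀) * Polynomial.X
    + Polynomial.C (F x₀ y₀ y x + F x₀ y y₀ x + F x₀ y y x₀ + F x y₀ y₀ x + F x y₀ y x₀
        + F x y y₀ x₀) * Polynomial.X ^ 2
    + Polynomial.C (F x y₀ y₀ x₀ + F x₀ y y₀ x₀ + F x₀ y₀ y x₀ + F x₀ y₀ y₀ x) * Polynomial.X ^ 3
    + Polynomial.C (F x₀ y₀ y₀ x₀) * Polynomial.X ^ 4
  let A (x x₀ y y₀ : V) : Polynomial ℝ := Polynomial.C (b x y)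
    + Polynomial.C (b x₀ y + b x y₀) * Polynomial.X + Polynomial.C (b x₀ y₀) * Polynomial.X ^ 2
  let Q : Polynomial ℝ := A x x₀ x x₀ * A y y₀ y y₀ - A x x₀ y y₀ ^ 2
  have hP : ∀ t : ℝ, P.eval t = F (x + t • x₀) (y + t • y₀) (y + t • y₀) (x + t • x₀) := by
    intro t
    simp only [P, hF.add, hF.smul, hF.add₁, hF.smul₁, hF.add₂, hF.smul₂, hF.add₃, hF.smul₃,
      Polynomial.eval_add, Polynomial.eval_mul, Polynomial.eval_C, Polynomial.eval_X,
      Polynomial.eval_pow]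
    ring
  have hA : ∀ (x x₀ y y₀ : V) (t : ℝ), (A x x₀ y y₀).eval t = b (x + t • x₀) (y + t • y₀) := by
    intro x x₀ y y₀ t
    simp only [A, map_add, map_smul, LinearMap.add_apply, LinearMap.smul_apply, smul_eq_mul,
      Polynomial.eval_add, Polynomial.eval_mul, Polynomial.eval_C, Polynomial.eval_X,
      Polynomial.eval_pow]
    ring
  -- For each `t` one factor vanishes, and `ℝ[X]` is a domain.
  have hPQ : P * Q = 0 := by
    refine Polynomial.funext fun t ↦ ?_
    rw [Polynomial.eval_mul, Polynomial.eval_zero, mul_eq_zero, hP]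
    by_cases hq : Q.eval t = 0
    · exact Or.inr hq
    · refine Or.inl (h _ _ ?_)
      simpa only [Q, Polynomial.eval_sub, Polynomial.eval_mul, Polynomial.eval_pow, hA] using hq
  rcases mul_eq_zero.1 hPQ with hp | hq
  · have := hP 0
    simpa [hp] using this.symm
  · exfalso
    apply h₀
    -- The top coefficient of `Q` is the Gram determinant of `(x₀, y₀)`, so `Q ≠ 0`.
    have h4 : Q.coeff 4 = b x₀ x₀ * b y₀ y₀ - b x₀ y₀ ^ 2 := by
      have : Q = Polynomial.C (b x x * b y y - b x y ^ 2)
          + Polynomial.C (b x x * (b y₀ y + b y y₀) + (b x₀ x + b x x₀) * b y y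
            - 2 * b x y * (b x₀ y + b x y₀)) * Polynomial.X
          + Polynomial.C (b x x * b y₀ y₀ + (b x₀ x + b x x₀) * (b y₀ y + b y y₀)
            + b x₀ x₀ * b y y - (b x₀ y + b x y₀) ^ 2 - 2 * b x y * b x₀ y₀) * Polynomial.X ^ 2
          + Polynomial.C ((b x₀ x + b x x₀) * b y₀ y₀ + b x₀ x₀ * (b y₀ y + b y y₀)
            - 2 * (b x₀ y + b x y₀) * b x₀ y₀) * Polynomial.X ^ 3
          + Polynomial.C (b x₀ x₀ * b y₀ y₀ - b x₀ y₀ ^ 2) * Polynomial.X ^ 4 := by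
        simp only [Q, A, Polynomial.C_add, Polynomial.C_sub, Polynomial.C_mul, Polynomial.C_pow,
          map_ofNat]
        ring
      rw [this]
      simp only [Polynomial.coeff_add, Polynomial.coeff_C_mul, Polynomial.coeff_C,
        Polynomial.coeff_X, Polynomial.coeff_X_pow]
      norm_num
    rw [← h4, hq, Polynomial.coeff_zero]

end IsCurvatureLike

end Algebra

/-! ### The curvature tensor of a space of constant curvature. -/

section Curvature

variable {E' : Type*} [NormedAddCommGroup E'] [NormedSpace ℝ E'] [FiniteDimensional ℝ E']
  {N : Type*} [TopologicalSpace N] [ChartedSpace E' N] [IsManifold 𝓘(ℝ, E') ∞ N]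
  {D : CovariantDerivative 𝓘(ℝ, E') E' (TangentSpace 𝓘(ℝ, E') : N → Type _)}
  {X Y Z W : Π x : N, TangentSpace 𝓘(ℝ, E') x}

lemma IsSmoothVF.covariantDerivative
    (hD : ContMDiffCovariantDerivativeOn E' ∞ D.toFun Set.univ)
    (hY : IsSmoothVF Y) (hX : IsSmoothVF X) : IsSmoothVF (fun x ↦ D Y x (X x)) :=
  ContMDiff.clm_bundle_apply (b := id)
    (contMDiffOn_univ.1 (hD.contMDiff (σ := Y) (ContMDiff.contMDiffOn hY))) hX

/-- The covariant curvature tensor of `D`. -/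
def curvatureForm (g : SemiRiemannianMetric E' N)
    (D : CovariantDerivative 𝓘(ℝ, E') E' (TangentSpace 𝓘(ℝ, E') : N → Type _))
    (X Y Z W : Π x : N, TangentSpace 𝓘(ℝ, E') x) (x : N) : ℝ :=
  g.val x (curvature (fun Z y v ↦ D Z y v) X Y Z x) (W x)

namespace SemiRiemannianMetric.IsLeviCivita

variable [T2Space N] {g : SemiRiemannianMetric E' N} (hD : g.IsLeviCivita D)
include hD

lemma curvature_antisymm (x : N) :
    curvature (fun Z y v ↦ D Z y v) X Y Z x = -curvature (fun Z y v ↦ D Z y v) Y X Z x := by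
  simp only [curvature]
  rw [VectorField.mlieBracket_swap_apply, map_neg]
  abel

/-- Torsion-freeness turns differences of covariant derivatives into brackets; the cyclic sum then
reduces to the Jacobi identity. -/
lemma bianchi (hX : IsSmoothVF X) (hY : IsSmoothVF Y) (hZ : IsSmoothVF Z) (x : N) :
    curvature (fun Z y v ↦ D Z y v) X Y Z x + curvature (fun Z y v ↦ D Z y v) Y Z X x
      + curvature (fun Z y v ↦ D Z y v) Z X Y x = 0 := by
  have := FiniteDimensional.complete ℝ E'
  have hm : IsManifold 𝓘(ℝ, E') (minSmoothness ℝ 3) N := by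
    rw [minSmoothness_of_isRCLikeNormedField]
    exact IsManifold.of_le (n := ∞) ENat.LEInfty.out
  have h2 : ∀ {X : Π p : N, TangentSpace 𝓘(ℝ, E') p}, IsSmoothVF X →
      ContMDiff 𝓘(ℝ, E') 𝓘(ℝ, E').tangent (minSmoothness ℝ 2)
        (fun q ↦ (⟨q, X q⟩ : TangentBundle 𝓘(ℝ, E') N)) := fun h ↦ by
    rw [minSmoothness_of_isRCLikeNormedField]
    exact h.of_le ENat.LEInfty.out
  have sub : ∀ {A B C : Π x : N, TangentSpace 𝓘(ℝ, E') x}, IsSmoothVF A → IsSmoothVF B →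
      IsSmoothVF C → D (fun y ↦ D B y (A y)) x (C x) - D (fun y ↦ D A y (B y)) x (C x)
        = D (VectorField.mlieBracket 𝓘(ℝ, E') A B) x (C x) := by
    intro A B C hA hB hC
    have h : (fun y ↦ D B y (A y))
        = VectorField.mlieBracket 𝓘(ℝ, E') A B + (fun y ↦ D A y (B y)) := by
      funext y
      have := hD.torsion_free A B y (hA.mdifferentiableAt y) (hB.mdifferentiableAt y)
      rw [Pi.add_apply, ← this]
      abel
    rw [h, D.isCovariantDerivativeOnUniv.add ((hA.mlieBracket hB).mdifferentiableAt x)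
      ((hA.covariantDerivative hD.smooth hB).mdifferentiableAt x), add_apply]
    abel
  have tor : ∀ {A B : Π x : N, TangentSpace 𝓘(ℝ, E') x}, IsSmoothVF A → IsSmoothVF B →
      D A x (B x) = D B x (A x) - VectorField.mlieBracket 𝓘(ℝ, E') A B x := fun {A B} hA hB ↦ by
    rw [← hD.torsion_free A B x (hA.mdifferentiableAt x) (hB.mdifferentiableAt x)]
    abel
  have hJ := VectorField.leibniz_identity_mlieBracket_apply (h2 hX x) (h2 hY x) (h2 hZ x)
  rw [VectorField.mlieBracket_swap (V := X) (W := Z)] at hJ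
  have e1 := sub hX hY hZ
  have e2 := sub hY hZ hX
  have e3 := sub hZ hX hY
  have t1 := tor (hX.mlieBracket hY) hZ
  have t2 := tor (hY.mlieBracket hZ) hX
  have t3 := tor (hZ.mlieBracket hX) hY
  have n1 : VectorField.mlieBracket 𝓘(ℝ, E') Y (-VectorField.mlieBracket 𝓘(ℝ, E') Z X) x
      = VectorField.mlieBracket 𝓘(ℝ, E') (VectorField.mlieBracket 𝓘(ℝ, E') Z X) Y x := by
    have h := VectorField.mlieBracket_const_smul_right (I := 𝓘(ℝ, E')) (c := (-1 : ℝ)) (V := Y)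
      (W := VectorField.mlieBracket 𝓘(ℝ, E') Z X) (x := x)
      ((hZ.mlieBracket hX).mdifferentiableAt x)
    rw [neg_one_smul, neg_one_smul] at h
    rw [h, VectorField.mlieBracket_swap_apply, neg_neg]
  rw [n1, VectorField.mlieBracket_swap_apply (V := X), neg_eq_iff_add_eq_zero] at hJ
  simp only [curvature]
  rw [sub_add_sub_comm, sub_add_sub_comm]
  calc _ = (D (fun y ↦ D Y y (X y)) x (Z x) - D (fun y ↦ D X y (Y y)) x (Z x))
        + (D (fun y ↦ D Z y (Y y)) x (X x) - D (fun y ↦ D Y y (Z y)) x (X x))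
        + (D (fun y ↦ D X y (Z y)) x (Y x) - D (fun y ↦ D Z y (X y)) x (Y x))
        - (D Z x (VectorField.mlieBracket 𝓘(ℝ, E') X Y x)
          + D X x (VectorField.mlieBracket 𝓘(ℝ, E') Y Z x)
          + D Y x (VectorField.mlieBracket 𝓘(ℝ, E') Z X x)) := by abel
    _ = 0 := by
      rw [e1, e2, e3, t1, t2, t3]
      rw [← neg_eq_zero, ← hJ]
      abel

/-- Apply `[X,Y] = XY - YX` to the function `g(Z,W)`: the mixed terms `g(∇Z, ∇W)` cancel. -/
lemma antisymm' (hX : IsSmoothVF X) (hY : IsSmoothVF Y) (hZ : IsSmoothVF Z) (hW : IsSmoothVF W)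
    (x : N) : curvatureForm g D X Y Z W x = -curvatureForm g D X Y W Z x := by
  have met : ∀ {A B : Π x : N, TangentSpace 𝓘(ℝ, E') x}, IsSmoothVF A → IsSmoothVF B →
      ∀ (y : N) (v : TangentSpace 𝓘(ℝ, E') y), mvfderiv 𝓘(ℝ, E') (fun y ↦ g.val y (A y) (B y)) y v
      = g.val y (D A y v) (B y) + g.val y (A y) (D B y v) := fun hA hB y v ↦
    hD.metric _ _ y v (hA.mdifferentiableAt y) (hB.mdifferentiableAt y)
  have sm : ∀ {A B : Π x : N, TangentSpace 𝓘(ℝ, E') x}, IsSmoothVF A → IsSmoothVF B →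
      ContMDiff 𝓘(ℝ, E') 𝓘(ℝ) ∞ (fun y ↦ g.val y (A y) (B y)) := fun hA hB y ↦
    g.contMDiffAt_apply (i := id) (hA y) (hB y)
  have h := mvfderiv_mlieBracket hX hY (sm hZ hW) x
  have dd : ∀ {A B : Π x : N, TangentSpace 𝓘(ℝ, E') x}, IsSmoothVF A → IsSmoothVF B →
      mvfderiv 𝓘(ℝ, E') (fun q ↦ mvfderiv 𝓘(ℝ, E') (fun y ↦ g.val y (Z y) (W y)) q (A q)) x (B x)
      = g.val x (D (fun y ↦ D Z y (A y)) x (B x)) (W x) + g.val x (D Z x (A x)) (D W x (B x))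
        + (g.val x (D Z x (B x)) (D W x (A x))
          + g.val x (Z x) (D (fun y ↦ D W y (A y)) x (B x))) := by
    intro A B hA hB
    have hZA := hZ.covariantDerivative hD.smooth hA
    have hWA := hW.covariantDerivative hD.smooth hA
    rw [funext fun q ↦ met hZ hW q (A q),
      mvfderiv_fun_add ((sm hZA hW x).mdifferentiableAt (by simp))
        ((sm hZ hWA x).mdifferentiableAt (by simp)), add_apply, met hZA hW, met hZ hWA]
  rw [met hZ hW, dd hY hX, dd hX hY] at h
  simp only [curvatureForm, curvature, map_sub, sub_apply]
  rw [g.symm x (D (fun q ↦ D W q (Y q)) x (X x)), g.symm x (D (fun q ↦ D W q (X q)) x (Y x)),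
    g.symm x (D W x (VectorField.mlieBracket 𝓘(ℝ, E') X Y x))]
  linarith

end SemiRiemannianMetric.IsLeviCivita

/-- In constant curvature, `R(X,Y)Z = c (g(Y,Z) X - g(X,Z) Y)`, at the points which have a
nondegenerate plane. -/
lemma SemiRiemannianMetric.HasConstantSectionalCurvature.curvature_eq [T2Space N]
    {g : SemiRiemannianMetric E' N} (hD : g.IsLeviCivita D) {c : ℝ}
    (hc : g.HasConstantSectionalCurvature D c) {x : N} {u₀ v₀ : TangentSpace 𝓘(ℝ, E') x}
    (h₀ : g.val x u₀ u₀ * g.val x v₀ v₀ - g.val x u₀ v₀ ^ 2 ≠ 0)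
    (hX : IsSmoothVF X) (hY : IsSmoothVF Y) (hZ : IsSmoothVF Z) :
    curvature (fun Z y v ↦ D Z y v) X Y Z x
      = c • (g.val x (Y x) (Z x) • X x - g.val x (X x) (Z x) • Y x) := by
  -- The algebra is applied to the real vector space of global fields, evaluated at `x`, instead of
  -- to the tangent space. This avoids proving beforehand that curvature is tensorial.
  let V : Submodule ℝ (Π x : N, TangentSpace 𝓘(ℝ, E') x) :=
    { carrier := {X | IsSmoothVF X}
      add_mem' := fun h h' ↦ h.add h'
      zero_mem' := fun _ ↦ smoothAlongAt_zero (i := id) contMDiffAt_id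
      smul_mem' := fun a _ h ↦ h.smul (f := fun _ ↦ a) contMDiff_const }
  let b : V →ₗ[ℝ] V →ₗ[ℝ] ℝ := LinearMap.mk₂ ℝ (fun X Y ↦ g.val x (X.1 x) (Y.1 x))
    (by simp) (by simp) (by simp) (by simp)
  have hb : ∀ X Y : V, b X Y = g.val x (X.1 x) (Y.1 x) := fun _ _ ↦ rfl
  have hbs : ∀ X Y : V, b X Y = b Y X := fun X Y ↦ g.symm _ _ _
  -- The curvature minus its constant curvature model; by hypothesis it vanishes on nondegenerate
  -- planes.
  let F (X Y Z W : V) : ℝ :=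
    curvatureForm g D X Y Z W x - c * (b Y Z * b X W - b X Z * b Y W)
  have hF : IsCurvatureLike F :=
    { add := fun X Y Z W W' ↦ by
        simp only [F, curvatureForm, Submodule.coe_add, Pi.add_apply, map_add]
        ring
      smul := fun X Y Z a W ↦ by
        simp only [F, curvatureForm, Submodule.coe_smul, Pi.smul_apply, map_smul, smul_eq_mul]
        ring
      antisymm := fun X Y Z W ↦ by
        simp only [F, curvatureForm, hD.curvature_antisymm (X := X.1), map_neg, neg_apply]
        ring
      antisymm' := fun X Y Z W ↦ by
        simp only [F, hD.antisymm' X.2 Y.2 Z.2 W.2]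
        ring
      bianchi := fun X Y Z W ↦ by
        have h := congrArg (fun v ↦ g.val x v (W.1 x)) (hD.bianchi X.2 Y.2 Z.2 x)
        simp only [map_add, add_apply, map_zero, zero_apply] at h
        simp only [F, curvatureForm]
        linear_combination h + c * (b X W * (hbs Z Y) + b Y W * (hbs X Z) + b Z W * (hbs Y X)) }
  obtain ⟨U, hU, rfl⟩ := exists_vf (M := N) u₀
  obtain ⟨U', hU', rfl⟩ := exists_vf (M := N) v₀
  have h1 := hF.eq_zero_of_nondegenerate_diag b (fun X Y hXY ↦ by
    simp only [hb] at hXY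
    have := hc X.1 Y.1 X.2 Y.2 x hXY
    rw [div_eq_iff hXY] at this
    simp only [F, curvatureForm, this, hb, g.symm x (Y.1 x) (X.1 x)]
    ring) (x₀ := ⟨U, hU⟩) (y₀ := ⟨U', hU'⟩) h₀
  refine sub_eq_zero.1 (g.nondegenerate x _ fun w ↦ ?_)
  obtain ⟨W, hW, rfl⟩ := exists_vf (M := N) w
  have h2 := h1 ⟨X, hX⟩ ⟨Y, hY⟩ ⟨Z, hZ⟩ ⟨W, hW⟩
  simp only [F, curvatureForm, hb] at h2
  simp only [map_sub, sub_apply, map_smul, smul_apply, smul_eq_mul]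
  exact h2

end Curvature

/-! ### Curvature of the pullback connection. -/

section CurvatureAlong

variable {E : Type*} [NormedAddCommGroup E] [NormedSpace ℝ E] [FiniteDimensional ℝ E]
  {M : Type*} [TopologicalSpace M] [T2Space M] [ChartedSpace E M] [IsManifold 𝓘(ℝ, E) ∞ M]
  {E' : Type*} [NormedAddCommGroup E'] [NormedSpace ℝ E'] [FiniteDimensional ℝ E']
  {N : Type*} [TopologicalSpace N] [T2Space N] [ChartedSpace E' N] [IsManifold 𝓘(ℝ, E') ∞ N]
  {D : CovariantDerivative 𝓘(ℝ, E') E' (TangentSpace 𝓘(ℝ, E') : N → Type _)}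
  {i : M → N} {p : M} {X Y : Π p : M, TangentSpace 𝓘(ℝ, E) p}

lemma mvfderiv_congr {f f' : M → ℝ} (h : f =ᶠ[𝓝 p] f') :
    mvfderiv 𝓘(ℝ, E) f p = mvfderiv 𝓘(ℝ, E) f' p := by
  ext v
  simp only [mvfderiv, h.mfderiv_eq]
  rfl

lemma mvfderiv_sum_mul {ι : Type*} (t : Finset ι) {f g : ι → M → ℝ}
    (hf : ∀ j, ContMDiff 𝓘(ℝ, E) 𝓘(ℝ) ∞ (f j)) (hg : ∀ j, ContMDiff 𝓘(ℝ, E) 𝓘(ℝ) ∞ (g j))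
    (u : TangentSpace 𝓘(ℝ, E) p) :
    mvfderiv 𝓘(ℝ, E) (fun q ↦ ∑ j ∈ t, f j q * g j q) p u
      = ∑ j ∈ t, (mvfderiv 𝓘(ℝ, E) (f j) p u * g j p + f j p * mvfderiv 𝓘(ℝ, E) (g j) p u) := by
  classical
  induction t using Finset.induction_on with
  | empty => simp [mvfderiv_const]
  | insert a t ha ih =>
    have hsum : ContMDiff 𝓘(ℝ, E) 𝓘(ℝ) ∞ (fun q ↦ ∑ j ∈ t, f j q * g j q) :=
      contMDiff_finsetSum fun j _ ↦ (hf j).mul (hg j)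
    have hfg : ContMDiff 𝓘(ℝ, E) 𝓘(ℝ) ∞ (fun q ↦ f a q * g a q) := (hf a).mul (hg a)
    simp only [Finset.sum_insert ha]
    rw [mvfderiv_fun_add ((hfg p).mdifferentiableAt (by simp))
      ((hsum p).mdifferentiableAt (by simp)), mvfderiv_fun_mul
      ((hf a p).mdifferentiableAt (by simp)) ((hg a p).mdifferentiableAt (by simp)),
      add_apply, ih, add_apply, smul_apply, smul_apply]
    simp only [smul_eq_mul]
    ring

lemma covAlong_zero (hi : ContMDiff 𝓘(ℝ, E) 𝓘(ℝ, E') ∞ i) (u : TangentSpace 𝓘(ℝ, E) p) :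
    covAlong D i (fun q ↦ (0 : TangentSpace 𝓘(ℝ, E') (i q))) p u = 0 := by
  refine (covAlong_comp (D := D) (p := p) hi (s := 0)
    (fun _ ↦ smoothAlongAt_zero (i := id) contMDiffAt_id) u).trans ?_
  rw [CovariantDerivative.zero]
  rfl

lemma covAlong_sum_smul {ι : Type*} (t : Finset ι) {f : ι → M → ℝ}
    {V : ι → Π p : M, TangentSpace 𝓘(ℝ, E') (i p)} (hi : ContMDiff 𝓘(ℝ, E) 𝓘(ℝ, E') ∞ i)
    (hf : ∀ j, ContMDiff 𝓘(ℝ, E) 𝓘(ℝ) ∞ (f j)) (hV : ∀ j, SmoothAlong (E := E) i (V j))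
    (u : TangentSpace 𝓘(ℝ, E) p) :
    covAlong D i (fun q ↦ ∑ j ∈ t, f j q • V j q) p u
      = ∑ j ∈ t, (mvfderiv 𝓘(ℝ, E) (f j) p u • V j p + f j p • covAlong D i (V j) p u) := by
  classical
  induction t using Finset.induction_on with
  | empty =>
    simpa using covAlong_zero hi u
  | insert a t ha ih =>
    simp only [Finset.sum_insert ha]
    rw [covAlong_add ((hV a p).smul (hf a p))
      (SmoothAlongAt.sum (hi p) fun j _ ↦ (hV j p).smul (hf j p)),
      covAlong_smul ((hf a p).mdifferentiableAt (by simp)) (hV a p), ih]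

section Frame

variable {ι : Type*} [Fintype ι] {s : ι → Π x : N, TangentSpace 𝓘(ℝ, E') x}
  {x y : ι → M → ℝ}

/-- The coordinate expression of the push-forward of a Lie bracket. -/
lemma diff_mlieBracket (hi : ContMDiff 𝓘(ℝ, E) 𝓘(ℝ, E') ∞ i) (hX : IsSmoothVF X)
    (hY : IsSmoothVF Y) (hs : ∀ j, IsSmoothVF (s j))
    (hx : ∀ j, ContMDiff 𝓘(ℝ, E) 𝓘(ℝ) ∞ (x j)) (hy : ∀ j, ContMDiff 𝓘(ℝ, E) 𝓘(ℝ) ∞ (y j))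
    (hXs : ∀ᶠ q in 𝓝 p, diff i q (X q) = ∑ j, x j q • s j (i q))
    (hYs : ∀ᶠ q in 𝓝 p, diff i q (Y q) = ∑ j, y j q • s j (i q)) :
    diff i p (VectorField.mlieBracket 𝓘(ℝ, E) X Y p)
      = ∑ k, (mvfderiv 𝓘(ℝ, E) (y k) p (X p) - mvfderiv 𝓘(ℝ, E) (x k) p (Y p)) • s k (i p)
        + ∑ k, ∑ l, (x l p * y k p) • VectorField.mlieBracket 𝓘(ℝ, E') (s l) (s k) (i p) := by
  -- Test on functions `f` of `N`: the push-forward of `[X,Y]` acts on `f` as `[X,Y]` acts on `f ∘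
  -- i`.
  refine sub_eq_zero.1 (eq_zero_of_mvfderiv_eq_zero fun f hf ↦ ?_)
  have hfi : ContMDiff 𝓘(ℝ, E) 𝓘(ℝ) ∞ (f ∘ i) := hf.comp hi
  have chain : ∀ {f : N → ℝ}, ContMDiff 𝓘(ℝ, E') 𝓘(ℝ) ∞ f → ∀ q (u : TangentSpace 𝓘(ℝ, E) q),
      mvfderiv 𝓘(ℝ, E) (f ∘ i) q u = mvfderiv 𝓘(ℝ, E') f (i q) (diff i q u) := fun hf q u ↦
    mvfderiv_comp_apply q ((hf _).mdifferentiableAt (by simp))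
      ((hi q).mdifferentiableAt (by simp)) u
  have hsf : ∀ k, ContMDiff 𝓘(ℝ, E') 𝓘(ℝ) ∞ (fun z ↦ mvfderiv 𝓘(ℝ, E') f z (s k z)) :=
    fun k ↦ hf.mvfderiv_apply (hs k)
  have key : ∀ {A B : Π p : M, TangentSpace 𝓘(ℝ, E) p} {a b : ι → M → ℝ},
      (∀ j, ContMDiff 𝓘(ℝ, E) 𝓘(ℝ) ∞ (b j)) →
      (∀ᶠ q in 𝓝 p, diff i q (A q) = ∑ j, a j q • s j (i q)) →
      (∀ᶠ q in 𝓝 p, diff i q (B q) = ∑ j, b j q • s j (i q)) →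
      mvfderiv 𝓘(ℝ, E) (fun q ↦ mvfderiv 𝓘(ℝ, E) (f ∘ i) q (B q)) p (A p)
        = ∑ k, mvfderiv 𝓘(ℝ, E) (b k) p (A p) * mvfderiv 𝓘(ℝ, E') f (i p) (s k (i p))
          + ∑ k, ∑ l, a l p * b k p * mvfderiv 𝓘(ℝ, E')
            (fun z ↦ mvfderiv 𝓘(ℝ, E') f z (s k z)) (i p) (s l (i p)) := by
    intro A B a b hb hA hB
    have h1 : (fun q ↦ mvfderiv 𝓘(ℝ, E) (f ∘ i) q (B q)) =ᶠ[𝓝 p] (fun q ↦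
        ∑ k, b k q * ((fun z ↦ mvfderiv 𝓘(ℝ, E') f z (s k z)) ∘ i) q) := by
      filter_upwards [hB] with q hq
      rw [chain hf, hq, map_sum]
      simp only [map_smul, smul_eq_mul, Function.comp]
    rw [mvfderiv_congr h1, mvfderiv_sum_mul _ hb (fun k ↦ (hsf k).comp hi),
      Finset.sum_add_distrib]
    congr 1
    refine Finset.sum_congr rfl fun k _ ↦ ?_
    rw [chain (hsf k), hA.self_of_nhds, map_sum, Finset.mul_sum]
    refine Finset.sum_congr rfl fun l _ ↦ ?_
    rw [map_smul, smul_eq_mul]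
    ring
  rw [map_sub, ← chain hf, mvfderiv_mlieBracket hX hY hfi, key hy hXs hYs, key hx hYs hXs, map_add,
    map_sum, map_sum]
  simp only [map_sum, map_smul, smul_eq_mul]
  simp only [mvfderiv_mlieBracket (hs _) (hs _) hf, mul_sub, sub_mul, Finset.sum_sub_distrib]
  rw [Finset.sum_comm (f := fun k l ↦ y l p * x k p * _)]
  simp only [mul_comm (y _ p)]
  ring

end Frame

/-- The curvature of a pullback connection is the pullback of the curvature. Both sides are linear
over functions in `V`, so `V = t ∘ i` suffices. -/
lemma SemiRiemannianMetric.HasConstantSectionalCurvature.curvature_along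
    {g : SemiRiemannianMetric E' N} (hD : g.IsLeviCivita D) {c : ℝ}
    (hc : g.HasConstantSectionalCurvature D c) (hi : ContMDiff 𝓘(ℝ, E) 𝓘(ℝ, E') ∞ i)
    {u₀ v₀ : TangentSpace 𝓘(ℝ, E') (i p)}
    (h₀ : g.val (i p) u₀ u₀ * g.val (i p) v₀ v₀ - g.val (i p) u₀ v₀ ^ 2 ≠ 0)
    (hX : IsSmoothVF X) (hY : IsSmoothVF Y) {V : Π p : M, TangentSpace 𝓘(ℝ, E') (i p)}
    (hV : SmoothAlong (E := E) i V) :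
    covAlong D i (fun q ↦ covAlong D i V q (Y q)) p (X p)
        - covAlong D i (fun q ↦ covAlong D i V q (X q)) p (Y p)
        - covAlong D i V p (VectorField.mlieBracket 𝓘(ℝ, E) X Y p)
      = c • (g.val (i p) (diff i p (Y p)) (V p) • diff i p (X p)
        - g.val (i p) (diff i p (X p)) (V p) • diff i p (Y p)) := by
  have hcov : ∀ {V : Π p : M, TangentSpace 𝓘(ℝ, E') (i p)} {X : Π p : M, TangentSpace 𝓘(ℝ, E) p},
      SmoothAlong (E := E) i V → IsSmoothVF X →
      SmoothAlong (E := E) i (fun q ↦ covAlong D i V q (X q)) :=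
    fun hV hX ↦ hV.covAlong hD.smooth hi hX
  refine SmoothAlong.induction hi p (V := V) (P := fun V ↦
    covAlong D i (fun q ↦ covAlong D i V q (Y q)) p (X p)
        - covAlong D i (fun q ↦ covAlong D i V q (X q)) p (Y p)
        - covAlong D i V p (VectorField.mlieBracket 𝓘(ℝ, E) X Y p)
      = c • (g.val (i p) (diff i p (Y p)) (V p) • diff i p (X p)
        - g.val (i p) (diff i p (X p)) (V p) • diff i p (Y p))) ?_ ?_ ?_ ?_ hV
  · intro V W _ _ h hV
    have h1 : ∀ Z : Π p : M, TangentSpace 𝓘(ℝ, E) p,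
        ∀ᶠ q in 𝓝 p, covAlong D i W q (Z q) = covAlong D i V q (Z q) := fun Z ↦
      (eventually_eventually_nhds.2 h).mono fun q hq ↦ covAlong_congr hq _
    rw [covAlong_congr (h1 Y), covAlong_congr (h1 X), covAlong_congr h, h.self_of_nhds]
    exact hV
  · intro V W hV hW h1 h2
    have h3 : ∀ Z : Π p : M, TangentSpace 𝓘(ℝ, E) p,
        (fun q ↦ covAlong D i (fun q ↦ V q + W q) q (Z q))
          = fun q ↦ covAlong D i V q (Z q) + covAlong D i W q (Z q) := fun Z ↦
      funext fun q ↦ covAlong_add (hV q) (hW q) _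
    rw [h3, h3, covAlong_add (hcov hV hY p) (hcov hW hY p),
      covAlong_add (hcov hV hX p) (hcov hW hX p), covAlong_add (hV p) (hW p), map_add, map_add]
    rw [← sub_eq_zero] at h1 h2 ⊢
    rw [← add_zero (0 : TangentSpace 𝓘(ℝ, E') (i p))]
    nth_rewrite 1 [← h1]
    rw [← h2]
    module
  · intro f V hf hV h
    have hf' : ∀ q, MDifferentiableAt 𝓘(ℝ, E) 𝓘(ℝ) f q :=
      fun q ↦ (hf q).mdifferentiableAt (by simp)
    have h3 : ∀ Z : Π p : M, TangentSpace 𝓘(ℝ, E) p,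
        (fun q ↦ covAlong D i (fun q ↦ f q • V q) q (Z q))
          = fun q ↦ mvfderiv 𝓘(ℝ, E) f q (Z q) • V q + f q • covAlong D i V q (Z q) := fun Z ↦
      funext fun q ↦ covAlong_smul (hf' q) (hV q) _
    -- The two terms with first derivatives of `f` are exchanged by swapping `A` and `B`, so they
    -- cancel; the second derivatives are absorbed by `[X,Y] f`.
    have h4 : ∀ {A B : Π p : M, TangentSpace 𝓘(ℝ, E) p}, IsSmoothVF A → IsSmoothVF B →
        covAlong D i (fun q ↦ mvfderiv 𝓘(ℝ, E) f q (B q) • V q + f q • covAlong D i V q (B q))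
          p (A p) = mvfderiv 𝓘(ℝ, E) (fun q ↦ mvfderiv 𝓘(ℝ, E) f q (B q)) p (A p) • V p
            + mvfderiv 𝓘(ℝ, E) f p (B p) • covAlong D i V p (A p)
            + (mvfderiv 𝓘(ℝ, E) f p (A p) • covAlong D i V p (B p)
            + f p • covAlong D i (fun q ↦ covAlong D i V q (B q)) p (A p)) := by
      intro A B hA hB
      have hfB := hf.mvfderiv_apply hB
      rw [covAlong_add ((hV p).smul (hfB p)) ((hcov hV hB p).smul (hf p)),
        covAlong_smul ((hfB p).mdifferentiableAt (by simp)) (hV p),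
        covAlong_smul (hf' p) (hcov hV hB p)]
    rw [h3, h3, h4 hX hY, h4 hY hX, covAlong_smul (hf' p) (hV p), mvfderiv_mlieBracket hX hY hf,
      map_smul, map_smul, smul_eq_mul, smul_eq_mul]
    rw [← sub_eq_zero] at h ⊢
    rw [← smul_zero (f p), ← h]
    module
  intro t ht
  obtain ⟨s, e, hs, he, hes⟩ := exists_frame (E := E) (M := M) (E' := E') (N := N) (i p)
  have he' := (hi p).continuousAt.eventually he
  have hcoef : ∀ {Z : Π p : M, TangentSpace 𝓘(ℝ, E) p}, IsSmoothVF Z → ∀ j,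
      ContMDiff 𝓘(ℝ, E) 𝓘(ℝ) ∞ (fun q ↦ e j (i q) (diff i q (Z q))) := fun hZ j q ↦
    hes i _ q j (smoothAlong_diff hi hZ q)
  have hsum : ∀ Z : Π p : M, TangentSpace 𝓘(ℝ, E) p, ∀ᶠ q in 𝓝 p,
      diff i q (Z q) = ∑ j, e j (i q) (diff i q (Z q)) • s j (i q) := fun Z ↦
    he'.mono fun q hq ↦ hq _
  have hDs : ∀ k, IsSmoothVF (fun z ↦ D t z (s k z)) :=
    fun k ↦ ht.covariantDerivative hD.smooth (hs k)
  have key : ∀ {A B : Π p : M, TangentSpace 𝓘(ℝ, E) p}, IsSmoothVF A → IsSmoothVF B →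
      covAlong D i (fun q ↦ covAlong D i (fun q ↦ t (i q)) q (B q)) p (A p)
        = ∑ k, mvfderiv 𝓘(ℝ, E) (fun q ↦ e k (i q) (diff i q (B q))) p (A p)
            • D t (i p) (s k (i p))
          + ∑ k, ∑ l, (e l (i p) (diff i p (A p)) * e k (i p) (diff i p (B p)))
            • D (fun z ↦ D t z (s k z)) (i p) (s l (i p)) := by
    intro A B hA hB
    have h1 : ∀ᶠ q in 𝓝 p, covAlong D i (fun q ↦ t (i q)) q (B q)
        = ∑ k, e k (i q) (diff i q (B q)) • D t (i q) (s k (i q)) := by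
      filter_upwards [hsum B] with q hq
      rw [covAlong_comp hi ht]
      conv_lhs => rw [hq]
      rw [map_sum]
      simp only [map_smul]
    rw [covAlong_congr h1, covAlong_sum_smul _ hi (hcoef hB)
      (fun k q ↦ SmoothAlongAt.comp (hDs k (i q)) (hi q)), Finset.sum_add_distrib]
    congr 1
    refine Finset.sum_congr rfl fun k _ ↦ ?_
    rw [covAlong_comp hi (hDs k)]
    conv_lhs => enter [2, 2]; rw [(hsum A).self_of_nhds]
    rw [map_sum, Finset.smul_sum]
    refine Finset.sum_congr rfl fun l _ ↦ ?_
    rw [map_smul, smul_smul, mul_comm]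
  -- The Ricci identity on `N` exchanges the two derivatives of `t`. Its bracket term will cancel
  -- that of `diff_mlieBracket`.
  have hR : ∀ k l, D (fun z ↦ D t z (s k z)) (i p) (s l (i p))
      = c • (g.val (i p) (s k (i p)) (t (i p)) • s l (i p)
          - g.val (i p) (s l (i p)) (t (i p)) • s k (i p))
        + D (fun z ↦ D t z (s l z)) (i p) (s k (i p))
        + D t (i p) (VectorField.mlieBracket 𝓘(ℝ, E') (s l) (s k) (i p)) := by
    intro k l
    rw [← hc.curvature_eq hD h₀ (hs l) (hs k) ht]
    simp only [curvature]
    abel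
  rw [key hX hY, key hY hX, covAlong_comp hi ht, diff_mlieBracket hi hX hY hs (hcoef hX) (hcoef hY)
    (hsum X) (hsum Y), map_add, map_sum, map_sum]
  set x := fun l ↦ e l (i p) (diff i p (X p)) with hx
  set y := fun l ↦ e l (i p) (diff i p (Y p)) with hy
  have hXp : diff i p (X p) = ∑ l, x l • s l (i p) := (hsum X).self_of_nhds
  have hYp : diff i p (Y p) = ∑ l, y l • s l (i p) := (hsum Y).self_of_nhds
  have h1 : ∑ k, ∑ l, (x l * y k) • D (fun z ↦ D t z (s k z)) (i p) (s l (i p))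
      = ∑ k, ∑ l, (x l * y k) • (c • (g.val (i p) (s k (i p)) (t (i p)) • s l (i p)
          - g.val (i p) (s l (i p)) (t (i p)) • s k (i p)))
        + ∑ k, ∑ l, (x l * y k) • D (fun z ↦ D t z (s l z)) (i p) (s k (i p))
        + ∑ k, ∑ l, (x l * y k) •
          D t (i p) (VectorField.mlieBracket 𝓘(ℝ, E') (s l) (s k) (i p)) := by
    simp only [← Finset.sum_add_distrib, ← smul_add]
    exact Finset.sum_congr rfl fun k _ ↦ Finset.sum_congr rfl fun l _ ↦ by rw [← hR k l]
  have h2 : ∑ k, ∑ l, (y l * x k) • D (fun z ↦ D t z (s k z)) (i p) (s l (i p))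
      = ∑ k, ∑ l, (x l * y k) • D (fun z ↦ D t z (s l z)) (i p) (s k (i p)) := by
    rw [Finset.sum_comm]
    simp only [mul_comm]
  have h3 : c • (g.val (i p) (diff i p (Y p)) (t (i p)) • diff i p (X p)
        - g.val (i p) (diff i p (X p)) (t (i p)) • diff i p (Y p))
      = ∑ k, ∑ l, (x l * y k) • (c • (g.val (i p) (s k (i p)) (t (i p)) • s l (i p)
          - g.val (i p) (s l (i p)) (t (i p)) • s k (i p))) := by
    rw [hXp, hYp]
    simp only [map_sum, map_smul, sum_apply, smul_apply, smul_eq_mul, smul_sub,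
      Finset.sum_sub_distrib, Finset.smul_sum, smul_smul]
    congr 1
    · rw [Finset.sum_comm]
      refine Finset.sum_congr rfl fun k _ ↦ ?_
      rw [Finset.sum_mul, Finset.mul_sum, Finset.sum_smul]
      refine Finset.sum_congr rfl fun l _ ↦ ?_
      congr 1
      ring
    · refine Finset.sum_congr rfl fun k _ ↦ ?_
      rw [Finset.sum_mul, Finset.mul_sum, Finset.sum_smul]
      refine Finset.sum_congr rfl fun l _ ↦ ?_
      congr 1
      ring
  rw [h1, h2, h3]
  simp only [map_sum, map_smul, map_sub, sub_smul, Finset.sum_sub_distrib]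
  abel

end CurvatureAlong

/-! ### Smooth dual frames from the Gram matrix. -/

section Gram

variable {E : Type*} [NormedAddCommGroup E] [NormedSpace ℝ E]
  {M : Type*} [TopologicalSpace M] [ChartedSpace E M] [IsManifold 𝓘(ℝ, E) ∞ M]
  {E' : Type*} [NormedAddCommGroup E'] [NormedSpace ℝ E'] [FiniteDimensional ℝ E']
  {N : Type*} [TopologicalSpace N] [ChartedSpace E' N] [IsManifold 𝓘(ℝ, E') ∞ N]
  {g : SemiRiemannianMetric E' N} {i : M → N} {p : M}
  {ι : Type*} [Fintype ι] [DecidableEq ι]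

lemma contMDiffAt_det {A : M → Matrix ι ι ℝ}
    (hA : ∀ j k, ContMDiffAt 𝓘(ℝ, E) 𝓘(ℝ) ∞ (fun q ↦ A q j k) p) :
    ContMDiffAt 𝓘(ℝ, E) 𝓘(ℝ) ∞ (fun q ↦ (A q).det) p := by
  simp only [Matrix.det_apply']
  exact contMDiffAt_finsetSum fun σ _ ↦ contMDiffAt_const.mul
    (contMDiffAt_finsetProd fun j _ ↦ hA _ _)

lemma contMDiffAt_matrix_inv {A : M → Matrix ι ι ℝ}
    (hA : ∀ j k, ContMDiffAt 𝓘(ℝ, E) 𝓘(ℝ) ∞ (fun q ↦ A q j k) p) (hp : (A p).det ≠ 0) (j k : ι) :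
    ContMDiffAt 𝓘(ℝ, E) 𝓘(ℝ) ∞ (fun q ↦ (A q)⁻¹ j k) p := by
  simp only [Matrix.inv_def, Matrix.smul_apply, Ring.inverse_eq_inv', smul_eq_mul,
    Matrix.adjugate_apply]
  refine ((contMDiffAt_det hA).inv₀ hp).mul (contMDiffAt_det fun a b ↦ ?_)
  by_cases h : a = k
  · subst h
    simpa using contMDiffAt_const
  · simpa [Matrix.updateRow_ne h] using hA a b

/-- The inverse Gram matrix of a frame along `i` is smooth. -/
lemma exists_gram_inverse (hι : Fintype.card ι = Module.finrank ℝ E')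
    {B : ι → Π p : M, TangentSpace 𝓘(ℝ, E') (i p)} (hB : ∀ j, SmoothAlong (E := E) i (B j))
    (hli : LinearIndependent ℝ fun j ↦ B j p) :
    ∃ θ : ι → ι → M → ℝ, ∀ᶠ q in 𝓝 p, (∀ j k, ContMDiffAt 𝓘(ℝ, E) 𝓘(ℝ) ∞ (θ j k) q) ∧
      (LinearIndependent ℝ fun j ↦ B j q) ∧
      (∀ v, v = ∑ j, (∑ k, θ j k q * g.val (i q) v (B k q)) • B j q) ∧
      ∀ k l, g.val (i q) (∑ j, θ j k q • B j q) (B l q) = if k = l then 1 else 0 := by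
  let A : M → Matrix ι ι ℝ := fun q ↦ Matrix.of fun j k ↦ g.val (i q) (B j q) (B k q)
  have hA : ∀ q j k, ContMDiffAt 𝓘(ℝ, E) 𝓘(ℝ) ∞ (fun q ↦ A q j k) q :=
    fun q j k ↦ g.contMDiffAt_apply (hB j q) (hB k q)
  have hfin : ∀ q, Fintype.card ι = Module.finrank ℝ (TangentSpace 𝓘(ℝ, E') (i q)) := fun _ ↦ hι
  have hAc : ∀ q (c : ι → ℝ) k, Matrix.mulVec (A q) c k
      = g.val (i q) (∑ j, c j • B j q) (B k q) := by
    intro q c k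
    simp only [Matrix.mulVec, dotProduct, A, Matrix.of_apply, map_sum, map_smul, sum_apply,
      smul_apply, smul_eq_mul]
    exact Finset.sum_congr rfl fun j _ ↦ by rw [g.symm, mul_comm]
  have hfd : ∀ q, FiniteDimensional ℝ (TangentSpace 𝓘(ℝ, E') (i q)) :=
    fun _ ↦ inferInstanceAs (FiniteDimensional ℝ E')
  -- A kernel vector would give a combination of the frame orthogonal to the whole frame, hence
  -- zero.
  have hp : (A p).det ≠ 0 := by
    intro h0
    obtain ⟨c, hc, hc0⟩ := Matrix.exists_mulVec_eq_zero_iff.2 h0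
    have hspan := hli.span_eq_top_of_card_eq_finrank' (hfin p)
    have : ∑ j, c j • B j p = 0 := by
      refine g.nondegenerate _ _ fun w ↦ ?_
      have hw : w ∈ Submodule.span ℝ (Set.range fun j ↦ B j p) := hspan ▸ Submodule.mem_top
      induction hw using Submodule.span_induction with
      | mem w hw =>
        obtain ⟨k, rfl⟩ := hw
        rw [← hAc, hc0]
        rfl
      | zero => simp
      | add a b _ _ ha hb => rw [map_add, ha, hb, add_zero]
      | smul a b _ hb => rw [map_smul, hb, smul_zero]
    exact hc (funext (Fintype.linearIndependent_iff.1 hli c this))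
  refine ⟨fun j k q ↦ (A q)⁻¹ j k, ?_⟩
  filter_upwards [(contMDiffAt_det (hA p)).continuousAt.eventually_ne hp] with q hq
  have hu : IsUnit (A q).det := hq.isUnit
  have hsymm : ∀ j k, A q j k = A q k j := fun j k ↦ g.symm _ _ _
  have hliq : LinearIndependent ℝ fun j ↦ B j q := by
    refine Fintype.linearIndependent_iff.2 fun c hc ↦ ?_
    have h0 : Matrix.mulVec (A q) c = 0 := funext fun k ↦ by
      rw [hAc, hc]
      simp
    have := Matrix.eq_zero_of_mulVec_eq_zero hq h0
    simp [this]
  refine ⟨fun j k ↦ contMDiffAt_matrix_inv (hA q) hq j k, hliq, fun v ↦ ?_, fun k l ↦ ?_⟩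
  · have hv : v ∈ Submodule.span ℝ (Set.range fun j ↦ B j q) :=
      hliq.span_eq_top_of_card_eq_finrank' (hfin q) ▸ Submodule.mem_top
    obtain ⟨c, rfl⟩ := (Submodule.mem_span_range_iff_exists_fun ℝ).1 hv
    refine Finset.sum_congr rfl fun j _ ↦ ?_
    congr 1
    simp only [← hAc]
    change c j = Matrix.mulVec (A q)⁻¹ (Matrix.mulVec (A q) c) j
    rw [Matrix.mulVec_mulVec, Matrix.nonsing_inv_mul _ hu, Matrix.one_mulVec]
  · rw [← hAc q (fun j ↦ (A q)⁻¹ j k) l]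
    change (A q * (A q)⁻¹) l k = _
    rw [Matrix.mul_nonsing_inv _ hu, Matrix.one_apply]
    simp only [eq_comm]

end Gram

/-! ### Adapted frames along the hypersurface. -/

section Frames

variable {E : Type*} [NormedAddCommGroup E] [NormedSpace ℝ E] [FiniteDimensional ℝ E]
  {M : Type*} [TopologicalSpace M] [T2Space M] [ChartedSpace E M] [IsManifold 𝓘(ℝ, E) ∞ M]
  {E' : Type*} [NormedAddCommGroup E'] [NormedSpace ℝ E'] [FiniteDimensional ℝ E']
  {N : Type*} [TopologicalSpace N] [T2Space N] [ChartedSpace E' N] [IsManifold 𝓘(ℝ, E') ∞ N]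
  {g : SemiRiemannianMetric E' N} {i : M → N}

lemma IsSmoothDistribution.exists_sections {k : ℕ}
    {S : Π p : M, Submodule ℝ (TangentSpace 𝓘(ℝ, E) p)} (hS : IsSmoothDistribution k S) (p : M) :
    ∃ s : Fin k → Π q : M, TangentSpace 𝓘(ℝ, E) q, (∀ j, IsSmoothVF (s j)) ∧
      (∀ j q, s j q ∈ S q) ∧ ∀ᶠ q in 𝓝 p, LinearIndependent ℝ (fun j ↦ s j q) ∧
        Submodule.span ℝ (Set.range fun j ↦ s j q) = S q := by
  obtain ⟨U, hU, hpU, s, hs, hsU⟩ := hS p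
  obtain ⟨χ, hχ, hχ1, hχU⟩ := exists_cutoff (E := E) (hU.mem_nhds hpU)
  refine ⟨fun j q ↦ χ q • s j q, fun j ↦ ?_, fun j q ↦ ?_, ?_⟩
  · exact SmoothAlong.of_cutoff (i := id) contMDiff_id hχ fun q hq ↦
      (hs j).contMDiffAt (hU.mem_nhds (hχU hq))
  · by_cases hq : q ∈ tsupport χ
    · refine Submodule.smul_mem _ _ ?_
      rw [← (hsU q (hχU hq)).2]
      exact Submodule.subset_span ⟨j, rfl⟩
    · simp [image_eq_zero_of_notMem_tsupport hq]
  · filter_upwards [hχ1, hU.mem_nhds hpU] with q h1 hq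
    simpa [h1] using hsU q hq

/-- Codimension one leaves room for one vector outside `di(T_p M)`; extending it to `N` and
restricting gives a smooth field along `i`. -/
lemma exists_frame_extension (hi : IsLightlikeHypersurface (E := E) g i) (p : M)
    {ι : Type*} {b : ι → TangentSpace 𝓘(ℝ, E) p} (hb : LinearIndependent ℝ b) :
    ∃ m : Π p : M, TangentSpace 𝓘(ℝ, E') (i p), SmoothAlong (E := E) i m ∧
      LinearIndependent ℝ fun o : Option ι ↦ o.elim (m p) fun j ↦ diff i p (b j) := by
  have hlt : LinearMap.range (diff (E := E) (E' := E') i p).toLinearMap ≠ ⊤ := by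
    intro h
    have h1 := LinearMap.finrank_range_of_inj (f := (diff (E := E) (E' := E') i p).toLinearMap)
      (hi.injective p)
    rw [h, finrank_top] at h1
    have h2 := hi.codim
    have h3 : Module.finrank ℝ E' = Module.finrank ℝ E := h1
    omega
  obtain ⟨v, hv⟩ : ∃ v, v ∉ LinearMap.range (diff (E := E) (E' := E') i p).toLinearMap := by
    by_contra! h
    exact hlt (eq_top_iff.2 fun v _ ↦ h v)
  obtain ⟨X, hX, hXv⟩ := exists_vf (E := E') v
  refine ⟨fun q ↦ X (i q), fun q ↦ SmoothAlongAt.comp (hX _) (hi.contMDiff q), ?_⟩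
  have h1 : LinearIndependent ℝ fun j ↦ diff i p (b j) :=
    hb.map' (diff (E := E) (E' := E') i p).toLinearMap (LinearMap.ker_eq_bot.2 (hi.injective p))
  beta_reduce
  rw [hXv]
  have h2 : v ∉ Submodule.span ℝ (Set.range fun j ↦ diff i p (b j)) := fun h ↦ hv
    (Submodule.span_le.2 (by rintro _ ⟨j, rfl⟩; exact ⟨b j, rfl⟩) h)
  have h3 : (fun o : Option ι ↦ o.elim v fun j ↦ diff i p (b j))
      = fun o ↦ Option.casesOn' o v fun j ↦ diff i p (b j) :=
    funext fun o ↦ by cases o <;> rfl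
  rw [h3]
  exact h1.option h2

/-- An immersion reflects smoothness of tangent vector fields. -/
lemma IsLightlikeHypersurface.smoothAt_of_diff (hi : IsLightlikeHypersurface (E := E) g i) {p : M}
    {V : Π p : M, TangentSpace 𝓘(ℝ, E') (i p)} (hV : SmoothAlong (E := E) i V)
    {u : Π p : M, TangentSpace 𝓘(ℝ, E) p} (hu : ∀ᶠ q in 𝓝 p, diff i q (u q) = V q) :
    SmoothAlongAt (E := E) id u p := by
  obtain ⟨s, e, hs, he, -⟩ := exists_frame (E := E) (M := M) (E' := E) (N := M) p
  have hli : LinearIndependent ℝ fun j ↦ s j p := by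
    refine linearIndependent_of_top_le_span_of_card_eq_finrank (fun v _ ↦ ?_)
      (Fintype.card_fin _)
    rw [he.self_of_nhds v]
    exact Submodule.sum_mem _ fun j _ ↦ Submodule.smul_mem _ _ (Submodule.subset_span ⟨j, rfl⟩)
  obtain ⟨m, hm, hml⟩ := exists_frame_extension hi p hli
  let B : Option (Fin (Module.finrank ℝ E)) → Π q : M, TangentSpace 𝓘(ℝ, E') (i q) :=
    fun o q ↦ o.elim (m q) fun j ↦ diff i q (s j q)
  have hB : ∀ o, SmoothAlong (E := E) i (B o) := by
    rintro (_ | j)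
    · exact hm
    · exact smoothAlong_diff hi.contMDiff (hs j)
  obtain ⟨θ, hθ⟩ := exists_gram_inverse (g := g) (by simp [hi.codim]) hB hml
  -- The coefficients of `u` in `s` are those of `V` in `B`, where the `m`-coefficient is 0. The
  -- inverse Gram matrix expresses them smoothly through `V`.
  refine SmoothAlongAt.congr (V := fun q ↦ ∑ j, (∑ k, θ (some j) k q * g.val (i q) (V q) (B k q))
    • s j q) (SmoothAlongAt.sum contMDiffAt_id fun j _ ↦ SmoothAlongAt.smul
      (contMDiffAt_finsetSum fun k _ ↦ (hθ.self_of_nhds.1 _ _).mul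
        (g.contMDiffAt_apply (hV p) (hB k p))) (hs j p)) ?_
  filter_upwards [hθ, hu, he] with q hq hu he
  obtain ⟨-, hl, hv, -⟩ := hq
  have h1 : ∑ o, (o.elim 0 (fun j ↦ e j q (u q)) : ℝ) • B o q = V q := by
    rw [Fintype.sum_option, ← hu]
    conv_rhs => rw [he (u q), map_sum]
    simp [B]
  have h2 := (Fintype.linearIndependent_iff.1 hl (fun o ↦ o.elim 0 (fun j ↦ e j q (u q))
    - ∑ k, θ o k q * g.val (i q) (V q) (B k q)) (by
      simp only [sub_smul, Finset.sum_sub_distrib]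
      rw [h1, ← hv, sub_self]))
  conv_lhs => rw [he (u q)]
  exact Finset.sum_congr rfl fun j _ ↦ by rw [← sub_eq_zero.1 (h2 (some j))]; rfl

end Frames

/-! ### The null transversal line and the tangential projection. -/

section Transversal

variable {E : Type*} [NormedAddCommGroup E] [NormedSpace ℝ E] [FiniteDimensional ℝ E]
  {M : Type*} [TopologicalSpace M] [T2Space M] [ChartedSpace E M] [IsManifold 𝓘(ℝ, E) ∞ M]
  {E' : Type*} [NormedAddCommGroup E'] [NormedSpace ℝ E'] [FiniteDimensional ℝ E']
  {N : Type*} [TopologicalSpace N] [T2Space N] [ChartedSpace E' N] [IsManifold 𝓘(ℝ, E') ∞ N]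
  {g : SemiRiemannianMetric E' N} {i : M → N} {S : ScreenDistribution (E := E) g i} {p : M}

lemma apply_radical_left {ξ : TangentSpace 𝓘(ℝ, E) p} (hξ : ξ ∈ radical (E := E) g i p)
    (u : TangentSpace 𝓘(ℝ, E) p) : g.val (i p) (diff i p ξ) (diff i p u) = 0 := hξ u

lemma apply_radical_right {ξ : TangentSpace 𝓘(ℝ, E) p} (hξ : ξ ∈ radical (E := E) g i p)
    (u : TangentSpace 𝓘(ℝ, E) p) : g.val (i p) (diff i p u) (diff i p ξ) = 0 := by
  rw [g.symm]
  exact hξ u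

variable (S) in
/-- A null normalization: `ξ` is radical, and `n` is the null vector orthogonal to the screen with
`g(n, ξ) = 1`. -/
structure IsNullPair (p : M) (ξ : TangentSpace 𝓘(ℝ, E) p) (n : TangentSpace 𝓘(ℝ, E') (i p)) :
    Prop where
  mem : ξ ∈ radical (E := E) g i p
  null : g.val (i p) n n = 0
  screen : ∀ w ∈ S.fiber p, g.val (i p) n (diff i p w) = 0
  pair : g.val (i p) n (diff i p ξ) = 1

namespace IsLightlikeHypersurface

variable (hi : IsLightlikeHypersurface (E := E) g i)
  {ξ : TangentSpace 𝓘(ℝ, E) p} {n : TangentSpace 𝓘(ℝ, E') (i p)}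
include hi

lemma exists_smul_eq_of_mem_radical (hξ : ξ ∈ Lightlike.radical (E := E) g i p) (h0 : ξ ≠ 0)
    {η : TangentSpace 𝓘(ℝ, E) p} (hη : η ∈ Lightlike.radical (E := E) g i p) :
    ∃ a : ℝ, η = a • ξ := by
  obtain ⟨s, -, -, hs⟩ := hi.radical.exists_sections p
  have h := hs.self_of_nhds.2
  rw [Set.range_unique] at h
  rw [← h] at hξ hη
  obtain ⟨a, rfl⟩ := Submodule.mem_span_singleton.1 hξ
  obtain ⟨b, rfl⟩ := Submodule.mem_span_singleton.1 hη
  have ha : a ≠ 0 := by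
    rintro rfl
    simp at h0
  exact ⟨b / a, by rw [smul_smul, div_mul_cancel₀ _ ha]⟩

/-- `ξ^⊥ = TM`. -/
lemma exists_diff_eq (hξ : ξ ∈ Lightlike.radical (E := E) g i p) (h0 : ξ ≠ 0)
    {v : TangentSpace 𝓘(ℝ, E') (i p)} (hv : g.val (i p) v (diff i p ξ) = 0) :
    ∃ u : TangentSpace 𝓘(ℝ, E) p, diff i p u = v := by
  have hfd : FiniteDimensional ℝ (TangentSpace 𝓘(ℝ, E') (i p)) :=
    inferInstanceAs (FiniteDimensional ℝ E')
  have hfd' : FiniteDimensional ℝ (TangentSpace 𝓘(ℝ, E) p) :=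
    inferInstanceAs (FiniteDimensional ℝ E)
  let φ : TangentSpace 𝓘(ℝ, E') (i p) →ₗ[ℝ] ℝ := (g.val (i p) (diff i p ξ)).toLinearMap
  let d : TangentSpace 𝓘(ℝ, E) p →ₗ[ℝ] TangentSpace 𝓘(ℝ, E') (i p) :=
    (diff (E := E) (E' := E') i p).toLinearMap
  have hφ : φ ≠ 0 := by
    intro h
    refine h0 (hi.injective p ?_)
    rw [map_zero]
    exact g.nondegenerate _ _ fun w ↦ LinearMap.congr_fun h w
  -- `TM ⊆ ξ^⊥`, and both have dimension `dim M`: `φ ≠ 0` because `g` is nondegenerate.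
  have h1 : LinearMap.range d ≤ LinearMap.ker φ := by
    rintro _ ⟨u, rfl⟩
    exact hξ u
  have h2 : Module.finrank ℝ (LinearMap.range d) = Module.finrank ℝ E :=
    LinearMap.finrank_range_of_inj (hi.injective p)
  have h3 := LinearMap.finrank_range_add_finrank_ker φ
  have h4 : Module.finrank ℝ (TangentSpace 𝓘(ℝ, E') (i p)) = Module.finrank ℝ E + 1 := hi.codim
  have h5 : LinearMap.range φ = ⊤ := LinearMap.range_eq_top.2 (LinearMap.surjective hφ)
  rw [h5, finrank_top, Module.finrank_self, h4] at h3
  have h6 : LinearMap.range d = LinearMap.ker φ :=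
    Submodule.eq_of_le_of_finrank_eq h1 (by omega)
  have h7 : v ∈ LinearMap.ker φ := by
    rw [LinearMap.mem_ker]
    exact (g.symm _ _ _).trans hv
  rw [← h6] at h7
  obtain ⟨u, hu⟩ := h7
  exact ⟨u, hu⟩

end IsLightlikeHypersurface

namespace IsNullPair

variable {ξ : TangentSpace 𝓘(ℝ, E) p} {n : TangentSpace 𝓘(ℝ, E') (i p)}
  (h : IsNullPair S p ξ n)
include h

lemma ne_zero : ξ ≠ 0 := by
  rintro rfl
  simpa using h.pair

/-- The Gram determinant is `-1`. This hyperbolic plane is the one required by `curvature_along`. -/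
lemma nondegenerate_plane : g.val (i p) (diff i p ξ) (diff i p ξ) * g.val (i p) n n
    - g.val (i p) (diff i p ξ) n ^ 2 ≠ 0 := by
  rw [h.null, g.symm, g.symm _ _ n, h.pair]
  norm_num

lemma mem_transversal (a : ℝ) : a • n ∈ transversal g i S p :=
  Submodule.smul_mem _ _ (Submodule.subset_span ⟨h.null, h.screen, ξ, h.mem, h.pair⟩)

/-- Uniqueness of the transversal direction: after scaling a generator `m`, `a m - n` lies in `ξ^⊥ =
TM` and is orthogonal to the screen, hence equals `b ξ`. Nullity gives `2b = 0`. -/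
lemma exists_eq_smul (hi : IsLightlikeHypersurface (E := E) g i)
    {v : TangentSpace 𝓘(ℝ, E') (i p)} (hv : v ∈ transversal g i S p) : ∃ a : ℝ, v = a • n := by
  induction hv using Submodule.span_induction with
  | mem m hm =>
    obtain ⟨hm0, hmS, η, hη, hmη⟩ := hm
    obtain ⟨a, rfl⟩ := hi.exists_smul_eq_of_mem_radical h.mem h.ne_zero hη
    rw [map_smul, map_smul, smul_eq_mul] at hmη
    have ha : a ≠ 0 := left_ne_zero_of_mul_eq_one hmη
    obtain ⟨u, hu⟩ := hi.exists_diff_eq h.mem h.ne_zero (v := a • m - n) (by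
      simp [hmη, h.pair])
    have hur : u ∈ radical (E := E) g i p := by
      intro w
      have hw : w ∈ radical (E := E) g i p ⊔ S.fiber p := (S.isCompl p).sup_eq_top ▸
        Submodule.mem_top
      obtain ⟨r, hr, t, ht, rfl⟩ := Submodule.mem_sup.1 hw
      rw [inducedMetric, map_add, map_add, apply_radical_right hr, hu]
      simp [hmS t ht, h.screen t ht]
    obtain ⟨b, rfl⟩ := hi.exists_smul_eq_of_mem_radical h.mem h.ne_zero hur
    have e1 : a • m = n + b • diff i p ξ := by rw [← map_smul, hu]; abel
    have e2 : g.val (i p) (a • m) (a • m) = 0 := by simp [hm0]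
    rw [e1] at e2
    simp only [map_add, map_smul, add_apply, smul_apply, smul_eq_mul, h.null, h.pair,
      apply_radical_left h.mem, g.symm _ (diff i p ξ) n] at e2
    have hb : b = 0 := by linarith
    refine ⟨a⁻¹, ?_⟩
    rw [hb, zero_smul, add_zero] at e1
    rw [← e1, smul_smul, inv_mul_cancel₀ ha, one_smul]
  | zero => exact ⟨0, by simp⟩
  | add x y _ _ hx hy =>
    obtain ⟨a, rfl⟩ := hx
    obtain ⟨b, rfl⟩ := hy
    exact ⟨a + b, (add_smul _ _ _).symm⟩
  | smul t x _ hx =>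
    obtain ⟨a, rfl⟩ := hx
    exact ⟨t * a, smul_smul _ _ _⟩

/-- The vector chosen in `tangentPart` is unique: pairing with `ξ` kills `TM` and reads off the
coefficient of `n`. -/
lemma tangentPart_add (hi : IsLightlikeHypersurface (E := E) g i) (u : TangentSpace 𝓘(ℝ, E) p)
    (a : ℝ) : tangentPart g i S p (diff i p u + a • n) = u := by
  have hex : ∃ w : TangentSpace 𝓘(ℝ, E) p,
      diff i p u + a • n - diff i p w ∈ transversal g i S p :=
    ⟨u, by simpa using h.mem_transversal a⟩
  rw [tangentPart, dif_pos hex]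
  have key : ∀ w, diff i p u + a • n - diff i p w ∈ transversal g i S p → w = u := by
    intro w hw
    obtain ⟨b, hb⟩ := h.exists_eq_smul hi hw
    have h1 := congrArg (fun v ↦ g.val (i p) v (diff i p ξ)) hb
    simp only [map_add, map_sub, map_smul, add_apply, sub_apply, smul_apply, smul_eq_mul, h.pair,
      apply_radical_right h.mem] at h1
    have hab : a = b := by linarith
    subst hab
    refine hi.injective p ?_
    have h2 := sub_eq_iff_eq_add.1 hb
    rw [add_comm] at h2
    exact (add_left_cancel h2).symm
  exact key _ hex.choose_spec

lemma diff_tangentPart (hi : IsLightlikeHypersurface (E := E) g i)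
    (v : TangentSpace 𝓘(ℝ, E') (i p)) :
    diff i p (tangentPart g i S p v) = v - g.val (i p) v (diff i p ξ) • n := by
  obtain ⟨u, hu⟩ := hi.exists_diff_eq h.mem h.ne_zero
    (v := v - g.val (i p) v (diff i p ξ) • n) (by simp [h.pair])
  have hv : v = diff i p u + g.val (i p) v (diff i p ξ) • n := by rw [hu, sub_add_cancel]
  rw [← hu]
  congr 1
  rw [hv]
  simpa using h.tangentPart_add hi u _

end IsNullPair

/-- Smooth local null normalizations exist. -/
lemma exists_isNullPair (hi : IsLightlikeHypersurface (E := E) g i)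
    (S : ScreenDistribution (E := E) g i) (p : M) :
    ∃ (Ξ : Π p : M, TangentSpace 𝓘(ℝ, E) p) (n : Π p : M, TangentSpace 𝓘(ℝ, E') (i p)),
      IsSmoothVF Ξ ∧ (∀ q, Ξ q ∈ radical (E := E) g i q) ∧ SmoothAlong (E := E) i n ∧
      (∀ q, g.val (i q) (n q) (n q) = 0) ∧ ∀ᶠ q in 𝓝 p, IsNullPair S q (Ξ q) (n q) := by
  obtain ⟨s, hs, hsr, hs'⟩ := hi.radical.exists_sections p
  obtain ⟨w, hw, -, hw'⟩ := S.smooth.exists_sections p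
  -- The screen rank `finrank E - 1` is a truncated subtraction.
  have hpos : 0 < Module.finrank ℝ E := by
    have : FiniteDimensional ℝ (TangentSpace 𝓘(ℝ, E) p) := inferInstanceAs (FiniteDimensional ℝ E)
    exact Module.finrank_pos_iff_exists_ne_zero.2
      ⟨s 0 p, hs'.self_of_nhds.1.ne_zero 0⟩
  let b : Fin 1 ⊕ Fin (Module.finrank ℝ E - 1) → Π q : M, TangentSpace 𝓘(ℝ, E) q := Sum.elim s w
  have hb : ∀ j, IsSmoothVF (b j) := Sum.rec hs hw
  have hbl : LinearIndependent ℝ fun j ↦ b j p := by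
    have h1 : Disjoint (Submodule.span ℝ (Set.range fun j ↦ s j p))
        (Submodule.span ℝ (Set.range fun j ↦ w j p)) := by
      rw [hs'.self_of_nhds.2, hw'.self_of_nhds.2]
      exact (S.isCompl p).disjoint
    have h2 : (fun j ↦ b j p) = Sum.elim (fun j ↦ s j p) (fun j ↦ w j p) :=
      funext fun j ↦ by cases j <;> rfl
    rw [h2]
    exact hs'.self_of_nhds.1.sum_type hw'.self_of_nhds.1 h1
  have hcard : Fintype.card (Fin 1 ⊕ Fin (Module.finrank ℝ E - 1)) = Module.finrank ℝ E := by
    simp only [Fintype.card_sum, Fintype.card_fin]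
    omega
  obtain ⟨m, hm, hml⟩ := exists_frame_extension hi p hbl
  let B : Option (Fin 1 ⊕ Fin (Module.finrank ℝ E - 1)) →
      Π q : M, TangentSpace 𝓘(ℝ, E') (i q) := fun o q ↦ o.elim (m q) fun j ↦ diff i q (b j q)
  have hB : ∀ o, SmoothAlong (E := E) i (B o) := by
    rintro (_ | j)
    · exact hm
    · exact smoothAlong_diff hi.contMDiff (hb j)
  obtain ⟨θ, hθ⟩ := exists_gram_inverse (g := g) (by
    rw [Fintype.card_option, hcard, hi.codim]) hB hml
  -- The dual frame vector of `ξ`; it already pairs to 1 with `ξ` and to 0 with the screen.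
  let n₁ : Π q : M, TangentSpace 𝓘(ℝ, E') (i q) := fun q ↦ ∑ o, θ o (some (Sum.inl 0)) q • B o q
  -- A multiple of `ξ` makes it null without changing its pairings with `TM`.
  let n₂ : Π q : M, TangentSpace 𝓘(ℝ, E') (i q) := fun q ↦
    n₁ q - (g.val (i q) (n₁ q) (n₁ q) / 2) • diff i q (s 0 q)
  have hgood : ∀ᶠ q in 𝓝 p, SmoothAlongAt (E := E) i n₂ q ∧ IsNullPair S q (s 0 q) (n₂ q) := by
    filter_upwards [hθ, hw'] with q hq hwq
    obtain ⟨hθq, -, -, hdual⟩ := hq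
    have hs1 : SmoothAlongAt (E := E) i n₁ q := SmoothAlongAt.sum (hi.contMDiff q)
      fun o _ ↦ SmoothAlongAt.smul (hθq _ _) (hB o q)
    have e1 : g.val (i q) (n₁ q) (diff i q (s 0 q)) = 1 := 
      (hdual (some (Sum.inl 0)) (some (Sum.inl 0))).trans (if_pos rfl)
    have e2 : ∀ j, g.val (i q) (n₁ q) (diff i q (w j q)) = 0 := fun j ↦ 
      (hdual (some (Sum.inl 0)) (some (Sum.inr j))).trans (if_neg (by simp))
    have e3 := apply_radical_left (hsr 0 q)
    refine ⟨hs1.sub (SmoothAlongAt.smul ?_ (smoothAlong_diff hi.contMDiff (hs 0) q)), hsr 0 q,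
      ?_, ?_, ?_⟩
    · simp only [div_eq_mul_inv]
      exact (g.contMDiffAt_apply hs1 hs1).mul contMDiffAt_const
    · simp only [n₂, map_sub, sub_apply, map_smul, smul_apply, smul_eq_mul, e1, e3,
        g.symm _ (diff i q (s 0 q)) (n₁ q)]
      ring
    · intro v hv
      rw [← hwq.2] at hv
      have hv0 : g.val (i q) (n₁ q) (diff i q v) = 0 := by
        induction hv using Submodule.span_induction with
        | mem v hv =>
          obtain ⟨j, rfl⟩ := hv
          exact e2 j
        | zero => simp
        | add a b _ _ ha hb => rw [map_add, map_add, ha, hb, add_zero]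
        | smul a b _ hb => rw [map_smul, map_smul, hb, smul_zero]
      simp [n₂, hv0, e3]
    · simp [n₂, e1, e3]
  -- The cut-off field is null everywhere, but normalized only near `p`.
  obtain ⟨χ, hχ, hχ1, hχU⟩ := exists_cutoff (E := E) hgood
  refine ⟨s 0, fun q ↦ χ q • n₂ q, hs 0, hsr 0,
    SmoothAlong.of_cutoff hi.contMDiff hχ fun q hq ↦ (hχU hq).1, fun q ↦ ?_, ?_⟩
  · by_cases hq : q ∈ tsupport χ
    · simp [(hχU hq).2.null]
    · simp [image_eq_zero_of_notMem_tsupport hq]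
  · filter_upwards [hχ1, hgood] with q h1 hq
    simpa [h1] using hq.2

end Transversal

/-! ### The induced connection and the second fundamental form. -/

section InducedConnection

variable {E : Type*} [NormedAddCommGroup E] [NormedSpace ℝ E] [FiniteDimensional ℝ E]
  {M : Type*} [TopologicalSpace M] [T2Space M] [ChartedSpace E M] [IsManifold 𝓘(ℝ, E) ∞ M]
  {E' : Type*} [NormedAddCommGroup E'] [NormedSpace ℝ E'] [FiniteDimensional ℝ E']
  {N : Type*} [TopologicalSpace N] [T2Space N] [ChartedSpace E' N] [IsManifold 𝓘(ℝ, E') ∞ N]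
  {g : SemiRiemannianMetric E' N}
  {D : CovariantDerivative 𝓘(ℝ, E') E' (TangentSpace 𝓘(ℝ, E') : N → Type _)}
  {i : M → N} {S : ScreenDistribution (E := E) g i} {p : M}
  {W X Y Z : Π p : M, TangentSpace 𝓘(ℝ, E) p}

lemma IsNullPair.diff_inducedConnection (hi : IsLightlikeHypersurface (E := E) g i)
    {ξ : TangentSpace 𝓘(ℝ, E) p} {n : TangentSpace 𝓘(ℝ, E') (i p)} (h : IsNullPair S p ξ n)
    (u : TangentSpace 𝓘(ℝ, E) p) :
    diff i p (inducedConnection g D i S Y p u) = covAlong D i (fun q ↦ diff i q (Y q)) p u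
      - g.val (i p) (covAlong D i (fun q ↦ diff i q (Y q)) p u) (diff i p ξ) • n :=
  h.diff_tangentPart hi _

/-- Reduces `h = 0` to the scalar equation `ḡ(∇̄_X Y, ξ) = 0`. -/
lemma IsNullPair.secondFundamentalForm_eq (hi : IsLightlikeHypersurface (E := E) g i)
    {ξ : TangentSpace 𝓘(ℝ, E) p} {n : TangentSpace 𝓘(ℝ, E') (i p)} (h : IsNullPair S p ξ n) :
    secondFundamentalForm g D i S X Y p
      = g.val (i p) (covAlong D i (fun q ↦ diff i q (Y q)) p (X p)) (diff i p ξ) • n := by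
  rw [secondFundamentalForm, h.diff_inducedConnection hi, sub_sub_cancel]

/-- The tangential part is smooth along `i`, and an immersion reflects smoothness. Needed to iterate
`∇` in `R` and `∇R`. -/
lemma isSmoothVF_inducedConnection (hD : g.IsLeviCivita D)
    (hi : IsLightlikeHypersurface (E := E) g i) (S : ScreenDistribution (E := E) g i)
    (hY : IsSmoothVF Y) (hX : IsSmoothVF X) :
    IsSmoothVF (fun q ↦ inducedConnection g D i S Y q (X q)) := by
  intro p
  obtain ⟨Ξ, n, hΞ, -, hn, -, h⟩ := exists_isNullPair hi S p
  have hV := (smoothAlong_diff hi.contMDiff hY).covAlong hD.smooth hi.contMDiff hX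
  refine hi.smoothAt_of_diff (V := fun q ↦ covAlong D i (fun q ↦ diff i q (Y q)) q (X q)
    - g.val (i q) (covAlong D i (fun q ↦ diff i q (Y q)) q (X q)) (diff i q (Ξ q)) • n q)
    (fun q ↦ ?_) ?_
  · exact (hV q).sub (SmoothAlongAt.smul
      (g.contMDiffAt_apply (hV q) (smoothAlong_diff hi.contMDiff hΞ q)) (hn q))
  · filter_upwards [h] with q hq
    exact hq.diff_inducedConnection hi _

/-! ### Totally geodesic implies parallel curvature. -/

section TotallyGeodesic

variable (hD : g.IsLeviCivita D) (hi : IsLightlikeHypersurface (E := E) g i)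
  (hS : IsTotallyGeodesic g D i S) {c : ℝ} (hc : g.HasConstantSectionalCurvature D c)
include hi hS

lemma IsTotallyGeodesic.diff_inducedConnection (hY : IsSmoothVF Y) (u : TangentSpace 𝓘(ℝ, E) p) :
    diff i p (inducedConnection g D i S Y p u) = covAlong D i (fun q ↦ diff i q (Y q)) p u := by
  obtain ⟨X, hX, rfl⟩ := exists_vf u
  exact (sub_eq_zero.1 (hS X Y hX hY p)).symm

include hD

lemma IsTotallyGeodesic.mvfderiv_inducedMetric (hX : IsSmoothVF X) (hY : IsSmoothVF Y)
    (u : TangentSpace 𝓘(ℝ, E) p) :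
    mvfderiv 𝓘(ℝ, E) (fun q ↦ inducedMetric g i q (X q) (Y q)) p u
      = inducedMetric g i p (inducedConnection g D i S X p u) (Y p)
        + inducedMetric g i p (X p) (inducedConnection g D i S Y p u) := by
  simp only [inducedMetric, hS.diff_inducedConnection hi hX, hS.diff_inducedConnection hi hY]
  exact hD.metric_along hi.contMDiff (smoothAlong_diff hi.contMDiff hX)
    (smoothAlong_diff hi.contMDiff hY) u

include hc

/-- With `h = 0` the iterated derivatives `∇∇Z` push forward to `∇̄∇̄Z`, so `R` is the restriction
of `R̄`. -/
lemma IsTotallyGeodesic.curvature_eq (hX : IsSmoothVF X) (hY : IsSmoothVF Y) (hZ : IsSmoothVF Z)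
    (p : M) : curvature (inducedConnection g D i S) X Y Z p
      = (c * inducedMetric g i p (Y p) (Z p)) • X p
        + (-c * inducedMetric g i p (X p) (Z p)) • Y p := by
  obtain ⟨Ξ, n, -, -, -, -, h⟩ := exists_isNullPair hi S p
  have h1 := hc.curvature_along hD hi.contMDiff h.self_of_nhds.nondegenerate_plane hX hY
    (smoothAlong_diff hi.contMDiff hZ)
  have h2 : ∀ {A : Π p : M, TangentSpace 𝓘(ℝ, E) p}, IsSmoothVF A →
      covAlong D i (fun q ↦ covAlong D i (fun q ↦ diff i q (Z q)) q (A q)) p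
        = fun u ↦ diff i p (inducedConnection g D i S
          (fun q ↦ inducedConnection g D i S Z q (A q)) p u) := fun hA ↦ funext fun u ↦ by
    rw [hS.diff_inducedConnection hi (isSmoothVF_inducedConnection hD hi S hZ hA)]
    simp only [hS.diff_inducedConnection hi hZ]
  rw [h2 hX, h2 hY, ← hS.diff_inducedConnection hi hZ] at h1
  refine hi.injective p ?_
  simp only [curvature, map_sub, map_add, map_smul]
  rw [h1]
  simp only [inducedMetric]
  module

/-- A totally geodesic lightlike hypersurface of a space of constant curvature has parallel
curvature. -/
lemma IsTotallyGeodesic.covDerivCurvature_eq_zero (hW : IsSmoothVF W) (hX : IsSmoothVF X)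
    (hY : IsSmoothVF Y) (hZ : IsSmoothVF Z) (p : M) :
    covDerivCurvature (inducedConnection g D i S) W X Y Z p = 0 := by
  have hsm : ∀ {A : Π p : M, TangentSpace 𝓘(ℝ, E) p}, IsSmoothVF A →
      IsSmoothVF (fun q ↦ inducedConnection g D i S A q (W q)) := fun hA ↦
    isSmoothVF_inducedConnection hD hi S hA hW
  have hmet : ∀ (a : ℝ) {A B : Π p : M, TangentSpace 𝓘(ℝ, E) p}, IsSmoothVF A → IsSmoothVF B →
      ContMDiff 𝓘(ℝ, E) 𝓘(ℝ) ∞ (fun q ↦ a * inducedMetric g i q (A q) (B q)) :=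
    fun a _ _ hA hB q ↦ contMDiffAt_const.mul (g.contMDiffAt_apply
      (smoothAlong_diff hi.contMDiff hA q) (smoothAlong_diff hi.contMDiff hB q))
  have hder : ∀ (a : ℝ) {A B : Π p : M, TangentSpace 𝓘(ℝ, E) p}, IsSmoothVF A → IsSmoothVF B →
      mvfderiv 𝓘(ℝ, E) (fun q ↦ a * inducedMetric g i q (A q) (B q)) p (W p)
        = a * (inducedMetric g i p (inducedConnection g D i S A p (W p)) (B p)
          + inducedMetric g i p (A p) (inducedConnection g D i S B p (W p))) := by
    intro a A B hA hB
    have h1 : ContMDiff 𝓘(ℝ, E) 𝓘(ℝ) ∞ (fun q ↦ inducedMetric g i q (A q) (B q)) := by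
      simpa using hmet 1 hA hB
    rw [mvfderiv_fun_mul mdifferentiableAt_const ((h1 p).mdifferentiableAt (by simp)), add_apply,
      smul_apply, smul_apply, mvfderiv_const, hS.mvfderiv_inducedMetric hD hi hA hB]
    simp
  -- The Leibniz rule in exactly the shape of `curvature_eq`. The derivatives of the coefficients
  -- come from `∇g = 0`, and all terms then cancel.
  have hlin : ∀ {f h : M → ℝ}, ContMDiff 𝓘(ℝ, E) 𝓘(ℝ) ∞ f → ContMDiff 𝓘(ℝ, E) 𝓘(ℝ) ∞ h →
      inducedConnection g D i S (fun q ↦ f q • X q + h q • Y q) p (W p)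
        = mvfderiv 𝓘(ℝ, E) f p (W p) • X p + f p • inducedConnection g D i S X p (W p)
          + (mvfderiv 𝓘(ℝ, E) h p (W p) • Y p + h p • inducedConnection g D i S Y p (W p)) := by
    intro f h hf hh
    refine hi.injective p ?_
    have hX' := smoothAlong_diff hi.contMDiff hX
    have hY' := smoothAlong_diff hi.contMDiff hY
    have hfh : IsSmoothVF (fun q ↦ f q • X q + h q • Y q) := (hX.smul hf).add (hY.smul hh)
    rw [hS.diff_inducedConnection hi hfh]
    simp only [map_add, map_smul, hS.diff_inducedConnection hi hX,
      hS.diff_inducedConnection hi hY]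
    rw [covAlong_add ((hX' p).smul (hf p)) ((hY' p).smul (hh p)),
      covAlong_smul ((hf p).mdifferentiableAt (by simp)) (hX' p),
      covAlong_smul ((hh p).mdifferentiableAt (by simp)) (hY' p)]
  rw [covDerivCurvature, funext (hS.curvature_eq hD hi hc hX hY hZ),
    hlin (hmet c hY hZ) (hmet (-c) hX hZ), hder c hY hZ, hder (-c) hX hZ,
    hS.curvature_eq hD hi hc (hsm hX) hY hZ, hS.curvature_eq hD hi hc hX (hsm hY) hZ,
    hS.curvature_eq hD hi hc hX hY (hsm hZ)]
  module

end TotallyGeodesic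

/-! ### Local symmetry with `c ≠ 0` implies totally geodesic. -/

section LocallySymmetric

variable (hD : g.IsLeviCivita D) (hi : IsLightlikeHypersurface (E := E) g i)
  {c : ℝ} (hc : g.HasConstantSectionalCurvature D c)
  {n : Π p : M, TangentSpace 𝓘(ℝ, E') (i p)}
  {Ξ : Π p : M, TangentSpace 𝓘(ℝ, E) p} (hΞ : IsSmoothVF Ξ)
  (hrad : ∀ q, Ξ q ∈ radical (E := E) g i q)
include hD hi hΞ hrad

/-- Differentiate `ḡ(Y, ξ) = 0`. -/
lemma apply_covAlong_radical (hY : IsSmoothVF Y) (u : TangentSpace 𝓘(ℝ, E) p) :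
    g.val (i p) (covAlong D i (fun q ↦ diff i q (Y q)) p u) (diff i p (Ξ p))
      = -g.val (i p) (diff i p (Y p)) (covAlong D i (fun q ↦ diff i q (Ξ q)) p u) := by
  have h1 := hD.metric_along hi.contMDiff (smoothAlong_diff hi.contMDiff hY)
    (smoothAlong_diff hi.contMDiff hΞ) u
  simp only [apply_radical_right (hrad _), mvfderiv_const, zero_apply] at h1
  linarith

/-- `ḡ(∇̄_u ξ, ξ) = 0` because `ξ` is null, so `∇̄_u ξ` is already tangent. -/
lemma IsNullPair.diff_inducedConnection_radical (h : IsNullPair S p (Ξ p) (n p))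
    (u : TangentSpace 𝓘(ℝ, E) p) : diff i p (inducedConnection g D i S Ξ p u)
      = covAlong D i (fun q ↦ diff i q (Ξ q)) p u := by
  have h1 := apply_covAlong_radical hD hi hΞ hrad hΞ u
  rw [g.symm _ (diff i p (Ξ p))] at h1
  rw [h.diff_inducedConnection hi, self_eq_neg.1 h1, zero_smul, sub_zero]

include hc

/-- As `∇ξ = ∇̄ξ` near `p`, this is the tangential part of `R̄(X,Y)ξ`, which vanishes because `ξ` is
orthogonal to `TM`. -/
lemma curvature_radical_eq_zero (h : ∀ᶠ q in 𝓝 p, IsNullPair S q (Ξ q) (n q))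
    (hX : IsSmoothVF X) (hY : IsSmoothVF Y) :
    curvature (inducedConnection g D i S) X Y Ξ p = 0 := by
  have hp := h.self_of_nhds
  have h1 := hc.curvature_along hD hi.contMDiff hp.nondegenerate_plane hX hY
    (smoothAlong_diff hi.contMDiff hΞ)
  rw [apply_radical_right (hrad p), apply_radical_right (hrad p), zero_smul, zero_smul, sub_zero,
    smul_zero] at h1
  have h2 : ∀ (A : Π p : M, TangentSpace 𝓘(ℝ, E) p) (u : TangentSpace 𝓘(ℝ, E) p),
      covAlong D i (fun q ↦ diff i q (inducedConnection g D i S Ξ q (A q))) p u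
        = covAlong D i (fun q ↦ covAlong D i (fun q ↦ diff i q (Ξ q)) q (A q)) p u := fun A u ↦
    covAlong_congr (h.mono fun q hq ↦ hq.diff_inducedConnection_radical hD hi hΞ hrad _) u
  refine hi.injective p ?_
  rw [map_zero]
  simp only [curvature, map_sub, hp.diff_inducedConnection hi, h2]
  have h3 := congrArg (fun v ↦ v - g.val (i p) v (diff i p (Ξ p)) • n p) h1
  simp only [map_sub, sub_apply, sub_smul, map_zero, zero_apply, zero_smul, sub_zero] at h3
  rw [← h3]
  abel

/-- Pairing with `n` does not distinguish `R` from `R̄`: the corrections are multiples of `n` and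
`∇̄n`, both orthogonal to `n`. -/
lemma apply_curvature_transversal (hn : SmoothAlong (E := E) i n)
    (hnull : ∀ q, g.val (i q) (n q) (n q) = 0) (h : ∀ᶠ q in 𝓝 p, IsNullPair S q (Ξ q) (n q))
    (hX : IsSmoothVF X) (hY : IsSmoothVF Y) (hZ : IsSmoothVF Z) :
    g.val (i p) (diff i p (curvature (inducedConnection g D i S) X Y Z p)) (n p)
      = c * (inducedMetric g i p (Y p) (Z p) * g.val (i p) (diff i p (X p)) (n p)
        - inducedMetric g i p (X p) (Z p) * g.val (i p) (diff i p (Y p)) (n p)) := by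
  have hp := h.self_of_nhds
  have hZ' := smoothAlong_diff hi.contMDiff hZ
  have h1 := hc.curvature_along hD hi.contMDiff hp.nondegenerate_plane hX hY hZ'
  have h2 : ∀ {A : Π p : M, TangentSpace 𝓘(ℝ, E) p} (u : TangentSpace 𝓘(ℝ, E) p),
      g.val (i p) (diff i p (inducedConnection g D i S A p u)) (n p)
        = g.val (i p) (covAlong D i (fun q ↦ diff i q (A q)) p u) (n p) := fun u ↦ by
    simp [hp.diff_inducedConnection hi, hp.null]
  have h3 : ∀ u : TangentSpace 𝓘(ℝ, E) p, g.val (i p) (covAlong D i n p u) (n p) = 0 := fun u ↦ by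
    have := hD.metric_along hi.contMDiff hn hn u
    simp only [hnull, mvfderiv_const, zero_apply, g.symm _ (n p)] at this
    linarith
  have h4 : ∀ {A : Π p : M, TangentSpace 𝓘(ℝ, E) p}, IsSmoothVF A →
      ∀ u : TangentSpace 𝓘(ℝ, E) p, g.val (i p)
          (covAlong D i (fun q ↦ diff i q (inducedConnection g D i S Z q (A q))) p u) (n p)
        = g.val (i p) (covAlong D i (fun q ↦ covAlong D i (fun q ↦ diff i q (Z q)) q (A q)) p u)
          (n p) := by
    intro A hA u
    have hV := hZ'.covAlong hD.smooth hi.contMDiff hA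
    have hβ : ContMDiffAt 𝓘(ℝ, E) 𝓘(ℝ) ∞ (fun q ↦ -g.val (i q)
        (covAlong D i (fun q ↦ diff i q (Z q)) q (A q)) (diff i q (Ξ q))) p :=
      (g.contMDiffAt_apply (hV p) (smoothAlong_diff hi.contMDiff hΞ p)).neg
    rw [covAlong_congr (V := fun q ↦ covAlong D i (fun q ↦ diff i q (Z q)) q (A q)
        + (-g.val (i q) (covAlong D i (fun q ↦ diff i q (Z q)) q (A q)) (diff i q (Ξ q))) • n q)
        (h.mono fun q hq ↦ by rw [hq.diff_inducedConnection hi, neg_smul, sub_eq_add_neg]),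
      covAlong_add (hV p) ((hn p).smul hβ),
      covAlong_smul (hβ.mdifferentiableAt (by simp)) (hn p)]
    simp [h3, hnull]
  have h5 := congrArg (fun v ↦ g.val (i p) v (n p)) h1
  simp only [map_sub, sub_apply, map_smul, smul_apply, smul_eq_mul] at h5
  simp only [curvature, map_sub, sub_apply, h2, h4 hX, h4 hY, inducedMetric]
  exact h5

omit hΞ hrad

lemma IsLocallySymmetric.isTotallyGeodesic (hc0 : c ≠ 0) (hS : IsLocallySymmetric g D i S) :
    IsTotallyGeodesic g D i S := by
  intro W Y hW hY p
  obtain ⟨Ξ, n, hΞ, hrad, hn, hnull, h⟩ := exists_isNullPair hi S p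
  have hp := h.self_of_nhds
  have hsm : ∀ {A : Π p : M, TangentSpace 𝓘(ℝ, E) p}, IsSmoothVF A →
      IsSmoothVF (fun q ↦ inducedConnection g D i S A q (W q)) := fun hA ↦
    isSmoothVF_inducedConnection hD hi S hA hW
  -- With `ξ` in the last slot, three of the four terms of `∇R` vanish, leaving `-R(ξ,Y)∇_W ξ`.
  have h1 := (hS W Ξ Y Ξ hW hΞ hY hΞ p).2 (n p) (by simpa using hp.mem_transversal 1)
  have hR : ∀ᶠ q in 𝓝 p, diff i q (curvature (inducedConnection g D i S) Ξ Y Ξ q)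
      = (0 : TangentSpace 𝓘(ℝ, E') (i q)) := by
    filter_upwards [eventually_eventually_nhds.2 h] with q hq
    rw [curvature_radical_eq_zero hD hi hc hΞ hrad hq hΞ hY, map_zero]
  have h2 : diff i p (inducedConnection g D i S (curvature (inducedConnection g D i S) Ξ Y Ξ) p
      (W p)) = (0 : TangentSpace 𝓘(ℝ, E') (i p)) := by
    rw [hp.diff_inducedConnection hi, covAlong_congr hR, covAlong_zero hi.contMDiff]
    simp
  simp only [covDerivCurvature, map_sub, h2,
    curvature_radical_eq_zero hD hi hc hΞ hrad h (hsm hΞ) hY,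
    curvature_radical_eq_zero hD hi hc hΞ hrad h hΞ (hsm hY), sub_zero, zero_sub] at h1
  -- The surviving pairing with `n` is `c g(Y, ∇_W ξ)`, which is `-c B(W,Y)`.
  rw [map_neg, neg_apply, neg_eq_zero,
    apply_curvature_transversal hD hi hc hΞ hrad hn hnull h hΞ hY (hsm hΞ), g.symm _ _ (n p),
    hp.pair, inducedMetric, inducedMetric, apply_radical_left (hrad p), zero_mul, sub_zero,
    mul_one, hp.diff_inducedConnection_radical hD hi hΞ hrad] at h1
  rw [hp.secondFundamentalForm_eq hi, apply_covAlong_radical hD hi hΞ hrad hY,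
    (mul_eq_zero.1 h1).resolve_left hc0, neg_zero, zero_smul]

end LocallySymmetric

end InducedConnection

end Lightlike

end

theorem proposition5p1
    {E : Type*} [NormedAddCommGroup E] [NormedSpace ℝ E] [FiniteDimensional ℝ E]
    {M : Type*} [TopologicalSpace M] [T2Space M] [SecondCountableTopology M]
    [ChartedSpace E M] [IsManifold 𝓘(ℝ, E) ∞ M]
    {E' : Type*} [NormedAddCommGroup E'] [NormedSpace ℝ E'] [FiniteDimensional ℝ E']
    {N : Type*} [TopologicalSpace N] [T2Space N] [SecondCountableTopology N]
    [ChartedSpace E' N] [IsManifold 𝓘(ℝ, E') ∞ N]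
    (g : Lightlike.SemiRiemannianMetric E' N)
    (D : CovariantDerivative 𝓘(ℝ, E') E' (TangentSpace 𝓘(ℝ, E') : N → Type _))
    (hD : g.IsLeviCivita D)
    (c : ℝ) (hc : g.HasConstantSectionalCurvature D c)
    (i : M → N) (hi : Lightlike.IsLightlikeHypersurface (E := E) g i)
    (S : Lightlike.ScreenDistribution (E := E) g i) :
    (Lightlike.IsTotallyGeodesic g D i S → Lightlike.IsLocallySymmetric g D i S) ∧
      (c ≠ 0 → (Lightlike.IsLocallySymmetric g D i S ↔ Lightlike.IsTotallyGeodesic g D i S)) := by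
  have h : Lightlike.IsTotallyGeodesic g D i S → Lightlike.IsLocallySymmetric g D i S := by
    intro hS W X Y Z hW hX hY hZ p
    rw [hS.covDerivCurvature_eq_zero hD hi hc hW hX hY hZ]
    simp [Lightlike.inducedMetric]
  exact ⟨h, fun hc0 ↦ ⟨fun hS ↦ hS.isTotallyGeodesic hD hi hc hc0, h⟩⟩
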